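/- Let $m$ be Lebesgue measure on $[0,1]$, write $\|\cdot\|_1$ for the norm of $L^1(m)$, and let $\Lambda=(\lambda_n)_{n\ge1}$ be an increasing sequence of positive real numbers with $\sum_n 1/\lambda_n<\infty$. Let $M_\Lambda^1$ be the closed linear span in $L^1(m)$ of the functions $x^{\lambda_n}$, $n\ge 1$ (real or complex scalars). Finite linear combinations of these functions are called $\Lambda$-polynomials. The sequence $\Lambda$ is called quasilacunary if there are an increasing sequence of integers $(n_k)$ and $q>1$ with $\lambda_{n_{k+1}}/\lambda_{n_k}\ge q$ for all $k$ and $\sup_k(n_{k+1}-n_k)<\infty$. A finite positive Borel measure $\mu$ on $[0,1]$ is called sublinear if there is $C>0$ with $\mu([1-\epsilon,1])\le C\epsilon$ for all $0<\epsilon<1$; the smallest such constant $C\ge 0$ is denoted by $\|\mu\|_S$. The measure $\mu$ is called $\Lambda$-embedding if there is $C>0$ with $\|p\|_{L^1(\mu)}\le C\|p\|_1$ for all $\Lambda$-polynomials $p$. **Theorem.** If $\Lambda$ is quasilacunary, then every sublinear measure $\mu$ is $\Lambda$-embedding. More precisely, there is a constant $C_\Lambda>0$, depending only on $\Lambda$,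 such that for every sublinear measure $\mu$ and every $\Lambda$-polynomial $p$, $$\|p\|_{L^1(\mu)}\le C_\Lambda\,\|\mu\|_S\,\|p\|_1 .$$ Moreover, every element of $M_\Lambda^1$ has a representative that is continuous on $[0,1)$, and, for every sublinear measure $\mu$, every such representative $f$ belongs to $L^1(\mu)$ and satisfies $\|f\|_{L^1(\mu)}\le C_\Lambda\|\mu\|_S\|f\|_1$. -/

import Mathlib

open MeasureTheory

/-- `Λ = (λ_n)_{n ≥ 1}`, with `Λ i = λ_{i+1}`, is an increasing sequence of positive real numbers
with `∑ 1 / λ_n < ∞`. -/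
structure IsMuntzSequence (Λ : ℕ → ℝ) : Prop where
  strictMono : StrictMono Λ
  pos : ∀ i, 0 < Λ i
  summable : Summable fun i => 1 / Λ i

/-- `Λ` is quasilacunary: for some increasing sequence of indices `n_k` and some `q > 1`,
`λ_{n_{k+1}} / λ_{n_k} ≥ q` for all `k`, and `sup_k (n_{k+1} - n_k) < ∞`. -/
def IsQuasilacunary (Λ : ℕ → ℝ) : Prop :=
  ∃ n : ℕ → ℕ, StrictMono n ∧
    (∃ q : ℝ, 1 < q ∧ ∀ k, q ≤ Λ (n (k + 1)) / Λ (n k)) ∧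
    ∃ N : ℕ, ∀ k, n (k + 1) ≤ n k + N

/-- Lebesgue measure `m` on `[0,1]`. -/
noncomputable def lebesgueUnit : Measure ℝ := volume.restrict (Set.Icc 0 1)

/-- The monomial function `x ↦ x ^ a`, with a real exponent `a`. -/
noncomputable def monomialFun (𝕜 : Type*) [RCLike 𝕜] (a : ℝ) : ℝ → 𝕜 :=
  fun x => ((x ^ a : ℝ) : 𝕜)

/-- The (Müntz) polynomials with exponents in `Λ`: finite linear combinations of the functions
`x ^ λ_n`. -/
noncomputable def muntzPolynomials (𝕜 : Type*) [RCLike 𝕜] (Λ : ℕ → ℝ) : Submodule 𝕜 (ℝ → 𝕜) :=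
  Submodule.span 𝕜 (Set.range fun i => monomialFun 𝕜 (Λ i))

/-- The Müntz space `M_Λ^1`: the closed linear span of the functions `x ^ λ_n` in `L^1(m)`. -/
noncomputable def muntzSpace (𝕜 : Type*) [RCLike 𝕜] (Λ : ℕ → ℝ) :
    Submodule 𝕜 (Lp 𝕜 1 lebesgueUnit) :=
  (Submodule.span 𝕜
    {F : Lp 𝕜 1 lebesgueUnit | ∃ i, F =ᵐ[lebesgueUnit] monomialFun 𝕜 (Λ i)}).topologicalClosure

/-- `μ` is a `Λ`-embedding measure: there is `C > 0` such that `‖p‖_{L^1(μ)} ≤ C ‖p‖_1` for all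
Müntz polynomials `p` with exponents in `Λ`. -/
def IsEmbeddingMeasure (𝕜 : Type*) [RCLike 𝕜] (Λ : ℕ → ℝ) (μ : Measure ℝ) : Prop :=
  ∃ C : ℝ, 0 < C ∧ ∀ p ∈ muntzPolynomials 𝕜 Λ,
    eLpNorm p 1 μ ≤ ENNReal.ofReal C * eLpNorm p 1 lebesgueUnit

/-- `μ(J_ε) ≤ C ε` for all `0 < ε < 1`, where `J_ε = [1 - ε, 1]`. -/
def SublinearBound (μ : Measure ℝ) (C : ℝ) : Prop :=
  ∀ ε : ℝ, 0 < ε → ε < 1 → μ (Set.Icc (1 - ε) 1) ≤ ENNReal.ofReal (C * ε)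

/-- `μ` is sublinear. -/
def IsSublinear (μ : Measure ℝ) : Prop :=
  ∃ C : ℝ, 0 < C ∧ SublinearBound μ C

/-- `‖μ‖_S`, the smallest constant `C` in the definition of sublinearity (it is `0` when `μ`
vanishes on `(0,1]`). -/
noncomputable def sublinearNorm (μ : Measure ℝ) : ℝ :=
  sInf {C : ℝ | 0 ≤ C ∧ SublinearBound μ C}

/-! With `x = exp (-t)` and `ν_i = λ_i + 1`, the `L^1` norm of `∑ a_i x ^ λ_i` becomes `∫_0^∞ |∑ a_i
exp (-ν_i t)| dt`. The heart of the proof is an increasing majorant of `|p|` with integral at most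
`C ‖p‖_1` (`exists_monotone_majorant`). Superlevel sets of an increasing function are intervals
ending at 1, on which `μ` is at most `‖μ‖_S` times Lebesgue measure, so the layer-cake formula gives
the embedding.

If all ratios of exponents were bounded away from 1, one could bound each `a_i` and take `∑ |a_i| x
^ λ_i`. Quasilacunarity allows exponents to cluster in groups of bounded size, and then single
coefficients are not controlled. So the indices are cut into blocks of at most `N` elements,
separated by a ratio `c > 1`, and inside a block the exponentials are replaced, by a triangular
change of basis, with the hypoexponential functions of its initial segments. These have bounds
independent of the gaps inside the block, and their coefficients satisfy `∑ |b_n| / ν_n ≤ C ∫ |f|`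
(`exists_sum_coeff_div_le`).

To isolate `b_n`, a polynomial in the translation by `1 / ν_n` is applied to `f`. Its roots kill the
neighbouring indices, a difference of order `M` damps the much smaller exponents, and the much
larger ones have already decayed at time `1 / ν_n`. The later indices of the block of `n` remain,
and weights growing along each block make them small. After averaging over `[1 / ν_n, 2 / ν_n]`, the
error matrix has column sums at most `1 / 2` and is absorbed.

The majorant also bounds `(1 - x) |p x|` by `C ‖p‖_1`, so `L^1` convergence of polynomials is
locally uniform on `[0, 1)`; Fatou's lemma then extends the inequality to the closed span. -/

/-! ### Hypoexponential functions. -/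

/-- The coefficient of `exp (-ν_j t)` in the hypoexponential function with rates `ν_i`, `i ∈ S`. -/
noncomputable def hypoCoeff (ν : ℕ → ℝ) (S : Finset ℕ) (j : ℕ) : ℝ :=
  ∏ i ∈ S.erase j, ν i / (ν i - ν j)

/-- The `r`-th derivative of the hypoexponential function with rates `ν_i`, `i ∈ S`: for `r = 0`
this is the probability that a sum of independent exponential variables with these rates
exceeds `t`. -/
noncomputable def hypoExp (ν : ℕ → ℝ) (S : Finset ℕ) (r : ℕ) (t : ℝ) : ℝ :=
  ∑ j ∈ S, hypoCoeff ν S j * (-ν j) ^ r * Real.exp (-ν j * t)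

lemma hypoExp_empty (ν : ℕ → ℝ) (r : ℕ) (t : ℝ) : hypoExp ν ∅ r t = 0 := by
  simp [hypoExp]

lemma hypoCoeff_insert_of_mem {ν : ℕ → ℝ} {S : Finset ℕ} {n j : ℕ} (hn : n ∉ S) (hj : j ∈ S) :
    hypoCoeff ν (insert n S) j = ν n / (ν n - ν j) * hypoCoeff ν S j := by
  have hnj : n ≠ j := fun h => hn (h ▸ hj)
  unfold hypoCoeff
  rw [Finset.erase_insert_of_ne hnj, Finset.prod_insert]
  exact fun h => hn (Finset.mem_of_mem_erase h)

/-- For `r = 0` this is the relaxation equation `g' = ν_n (h - g)`. It never divides by a difference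
of rates, so the bounds derived from it ignore the gaps. -/
lemma hypoExp_succ_insert {ν : ℕ → ℝ} (hν : Function.Injective ν) {S : Finset ℕ} {n : ℕ}
    (hn : n ∉ S) (r : ℕ) (t : ℝ) :
    hypoExp ν (insert n S) (r + 1) t = ν n * (hypoExp ν S r t - hypoExp ν (insert n S) r t) := by
  unfold hypoExp
  rw [Finset.sum_insert hn, Finset.sum_insert hn]
  have : ∑ j ∈ S, hypoCoeff ν (insert n S) j * (-ν j) ^ (r + 1) * Real.exp (-ν j * t) =
      ν n * (∑ j ∈ S, hypoCoeff ν S j * (-ν j) ^ r * Real.exp (-ν j * t) -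
        ∑ j ∈ S, hypoCoeff ν (insert n S) j * (-ν j) ^ r * Real.exp (-ν j * t)) := by
    rw [← Finset.sum_sub_distrib, Finset.mul_sum]
    refine Finset.sum_congr rfl fun j hj => ?_
    have hnj : ν n - ν j ≠ 0 := sub_ne_zero.2 fun h => hn (hν h ▸ hj)
    rw [hypoCoeff_insert_of_mem hn hj, pow_succ]
    field_simp
    ring
  rw [this]
  ring

lemma hasDerivAt_hypoExp (ν : ℕ → ℝ) (S : Finset ℕ) (r : ℕ) (t : ℝ) :
    HasDerivAt (hypoExp ν S r) (hypoExp ν S (r + 1) t) t := by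
  unfold hypoExp
  refine HasDerivAt.fun_sum fun j _ => ?_
  have h : HasDerivAt (fun t => Real.exp (-ν j * t)) (Real.exp (-ν j * t) * -ν j) t := by
    simpa using ((hasDerivAt_id t).const_mul (-ν j)).exp
  exact (h.const_mul (hypoCoeff ν S j * (-ν j) ^ r)).congr_deriv (by rw [pow_succ]; ring)

/-- The coefficients are the values at 0 of the Lagrange basis polynomials with nodes `ν_i`, whose
sum is 1. -/
lemma hypoExp_zero {ν : ℕ → ℝ} (hν : Function.Injective ν) {S : Finset ℕ} (hS : S.Nonempty) :
    hypoExp ν S 0 0 = 1 := by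
  have h := congrArg (Polynomial.eval 0) (Lagrange.sum_basis (v := ν) (s := S) hν.injOn hS)
  rw [Polynomial.eval_finsetSum, Polynomial.eval_one] at h
  rw [← h]
  unfold hypoExp hypoCoeff
  refine Finset.sum_congr rfl fun j _ => ?_
  simp only [pow_zero, mul_one, mul_zero, Real.exp_zero, Lagrange.basis, Polynomial.eval_prod]
  refine Finset.prod_congr rfl fun i _ => ?_
  simp only [Lagrange.basisDivisor, Polynomial.eval_mul, Polynomial.eval_C, Polynomial.eval_sub,
    Polynomial.eval_X]
  rw [zero_sub, ← neg_sub (ν i) (ν j), inv_neg, neg_mul_neg, div_eq_inv_mul]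

/-- Exponential decay of the solutions of `g' = v (h - g)`. -/
lemma abs_le_of_relaxation {g h : ℝ → ℝ} {v κ C B : ℝ} (hC : 1 ≤ C) (hB : 1 ≤ B) (hv : 0 ≤ v)
    (hκ : v ≤ B * (v - κ))
    (hg0 : g 0 = 1) (hg : ∀ t, HasDerivAt g (v * (h t - g t)) t)
    (hh : ∀ t, 0 ≤ t → |h t| ≤ C * Real.exp (-κ * t)) {t : ℝ} (ht : 0 ≤ t) :
    |g t| ≤ C * B * Real.exp (-κ * t) := by
  -- Since `(exp (v t) g)' = v exp (v t) h`, this function is compared with `C B exp ((v - κ) t)`;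
  -- the hypothesis `v ≤ B (v - κ)` orders the two derivatives.
  have key := image_norm_le_of_norm_deriv_right_le_deriv_boundary (a := 0) (b := t)
    (f := fun t => Real.exp (v * t) * g t) (f' := fun t => Real.exp (v * t) * (v * h t))
    (B := fun t => C * B * Real.exp ((v - κ) * t))
    (B' := fun t => C * B * (Real.exp ((v - κ) * t) * (v - κ))) ?_ ?_ ?_ ?_ ?_
    (Set.right_mem_Icc.2 ht)
  · rw [Real.norm_eq_abs, abs_mul, Real.abs_exp] at key
    have : Real.exp ((v - κ) * t) = Real.exp (v * t) * Real.exp (-κ * t) := by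
      rw [← Real.exp_add]; ring_nf
    rw [this] at key
    refine le_of_mul_le_mul_left ?_ (Real.exp_pos (v * t))
    linarith
  · have : Continuous g := continuous_iff_continuousAt.2 fun t => (hg t).continuousAt
    fun_prop
  · intro x _
    have h1 : HasDerivAt (fun t => Real.exp (v * t)) (Real.exp (v * x) * v) x := by
      simpa using ((hasDerivAt_id x).const_mul v).exp
    exact ((h1.mul (hg x)).congr_deriv (by ring)).hasDerivWithinAt
  · simp only [mul_zero, Real.exp_zero, hg0, norm_one, mul_one]
    nlinarith
  · intro x
    have h1 : HasDerivAt (fun t => Real.exp ((v - κ) * t)) (Real.exp ((v - κ) * x) * (v - κ)) x := by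
      simpa using ((hasDerivAt_id x).const_mul (v - κ)).exp
    exact h1.const_mul _
  · intro x hx
    rw [Real.norm_eq_abs, abs_mul, Real.abs_exp, abs_mul, abs_of_nonneg hv]
    have : Real.exp ((v - κ) * x) = Real.exp (v * x) * Real.exp (-κ * x) := by
      rw [← Real.exp_add]; ring_nf
    rw [this]
    have h1 : v * |h x| ≤ B * (v - κ) * (C * Real.exp (-κ * x)) :=
      mul_le_mul hκ (hh x hx.1) (abs_nonneg _) (hv.trans hκ)
    nlinarith [mul_le_mul_of_nonneg_left h1 (Real.exp_pos (v * x)).le]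

lemma abs_hypoExp_le {ν : ℕ → ℝ} (hν : Function.Injective ν) {κ B : ℝ} (hB : 1 ≤ B)
    (S : Finset ℕ) (hpos : ∀ j ∈ S, 0 ≤ ν j) (hκ : ∀ j ∈ S, ν j ≤ B * (ν j - κ)) {t : ℝ}
    (ht : 0 ≤ t) : |hypoExp ν S 0 t| ≤ B ^ S.card * Real.exp (-κ * t) := by
  induction S using Finset.induction_on generalizing t with
  | empty => rw [hypoExp_empty, abs_zero]; positivity
  | insert n S hn ih =>
    rw [Finset.card_insert_of_notMem hn, pow_succ]
    refine abs_le_of_relaxation (v := ν n) (h := hypoExp ν S 0) (one_le_pow₀ hB) hB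
      (hpos n (Finset.mem_insert_self _ _)) (hκ n (Finset.mem_insert_self _ _))
      (hypoExp_zero hν (Finset.insert_nonempty _ _)) (fun u => ?_) (fun u hu => ?_) ht
    · rw [← hypoExp_succ_insert hν hn]
      exact hasDerivAt_hypoExp _ _ _ _
    · exact ih (fun j hj => hpos j (Finset.mem_insert_of_mem hj))
        (fun j hj => hκ j (Finset.mem_insert_of_mem hj)) hu

/-- Each derivative is a rate times a difference of two functions of the previous order, hence a
factor `2 V` per derivative. -/
lemma abs_hypoExp_deriv_le {ν : ℕ → ℝ} (hν : Function.Injective ν) {V : ℝ} (hV : 0 ≤ V)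
    (r : ℕ) (S : Finset ℕ) (hpos : ∀ j ∈ S, 0 ≤ ν j ∧ ν j ≤ V) {t : ℝ}
    (ht : 0 ≤ t) : |hypoExp ν S r t| ≤ (2 * V) ^ r := by
  induction r generalizing S with
  | zero =>
    simpa using abs_hypoExp_le hν (κ := 0) le_rfl S (fun j hj => (hpos j hj).1)
      (fun j _ => by simp) ht
  | succ r ih =>
    rcases S.eq_empty_or_nonempty with rfl | ⟨n, hn⟩
    · rw [hypoExp_empty, abs_zero]; positivity
    · have h1 := hypoExp_succ_insert hν (Finset.notMem_erase n S) r t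
      rw [Finset.insert_erase hn] at h1
      have h2 := ih (S.erase n) (fun j hj => hpos j (Finset.mem_of_mem_erase hj))
      have h3 := ih S hpos
      rw [h1, abs_mul, abs_of_nonneg (hpos n hn).1, pow_succ]
      have h4 := (abs_sub (hypoExp ν (S.erase n) r t) (hypoExp ν S r t)).trans (add_le_add h2 h3)
      calc ν n * |hypoExp ν (S.erase n) r t - hypoExp ν S r t|
          ≤ V * ((2 * V) ^ r + (2 * V) ^ r) :=
            mul_le_mul (hpos n hn).2 h4 (abs_nonneg _) hV
        _ = (2 * V) ^ r * (2 * V) := by ring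

/-! ### Polynomials in a translation. -/

/-- The translation `g ↦ g (· + a)`. -/
noncomputable def translation (a : ℝ) : Module.End ℝ (ℝ → ℝ) :=
  LinearMap.funLeft ℝ ℝ fun t => t + a

lemma translation_apply (a : ℝ) (g : ℝ → ℝ) (t : ℝ) : translation a g t = g (t + a) := rfl

lemma aeval_translation_factor (a w : ℝ) (g : ℝ → ℝ) (t : ℝ) :
    Polynomial.aeval (translation a) (Polynomial.C w - Polynomial.X) g t = w * g t - g (t + a) := by
  simp [translation_apply, Module.algebraMap_end_apply]

lemma aeval_translation_exp (a v : ℝ) (P : Polynomial ℝ) :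
    Polynomial.aeval (translation a) P (fun t => Real.exp (-v * t)) =
      P.eval (Real.exp (-v * a)) • fun t => Real.exp (-v * t) := by
  refine Module.End.aeval_apply_of_hasEigenvector ⟨?_, ?_⟩
  · rw [Module.End.mem_eigenspace_iff]
    ext t
    rw [translation_apply, Pi.smul_apply, smul_eq_mul, ← Real.exp_add]
    ring_nf
  · intro h
    have := congrFun h 0
    simp at this

/-- `P (translation a)` has norm at most `2 ^ d` on bounded functions and on integrable functions,
and looks ahead by at most `d * a`. -/
structure TranslationBound (a : ℝ) (P : Polynomial ℝ) (d : ℕ) : Prop where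
  abs_le : ∀ (g : ℝ → ℝ) (C t₀ : ℝ), (∀ t, t₀ ≤ t → |g t| ≤ C) →
    ∀ t, t₀ ≤ t → |Polynomial.aeval (translation a) P g t| ≤ 2 ^ d * C
  continuous : ∀ g : ℝ → ℝ, Continuous g → Continuous (Polynomial.aeval (translation a) P g)
  integral_le : ∀ g : ℝ → ℝ, Continuous g → ∀ u v : ℝ, u ≤ v →
    ∫ t in u..v, |Polynomial.aeval (translation a) P g t| ≤ 2 ^ d * ∫ t in u..(v + d * a), |g t|

namespace TranslationBound

lemma one (a : ℝ) : TranslationBound a 1 0 where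
  abs_le g C t₀ h t ht := by simpa using h t ht
  continuous g hg := by simpa using hg
  integral_le g hg u v huv := by simp

lemma mul {a : ℝ} (ha : 0 ≤ a) {P Q : Polynomial ℝ} {d e : ℕ} (hP : TranslationBound a P d)
    (hQ : TranslationBound a Q e) : TranslationBound a (P * Q) (d + e) where
  abs_le g C t₀ h t ht := by
    rw [map_mul, Module.End.mul_apply, pow_add, mul_assoc]
    exact hP.abs_le _ _ _ (hQ.abs_le g C t₀ h) t ht
  continuous g hg := by
    rw [map_mul, Module.End.mul_apply]
    exact hP.continuous _ (hQ.continuous g hg)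
  integral_le g hg u v huv := by
    rw [map_mul, Module.End.mul_apply, pow_add, mul_assoc]
    refine (hP.integral_le _ (hQ.continuous g hg) u v huv).trans ?_
    have h := hQ.integral_le g hg u (v + d * a) (by nlinarith [mul_nonneg (Nat.cast_nonneg d) ha])
    refine mul_le_mul_of_nonneg_left (h.trans_eq ?_) (by positivity)
    push_cast
    ring_nf

lemma factor {a : ℝ} (ha : 0 ≤ a) {w : ℝ} (hw : |w| ≤ 1) :
    TranslationBound a (Polynomial.C w - Polynomial.X) 1 where
  abs_le g C t₀ h t ht := by
    rw [aeval_translation_factor]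
    have h1 := h t ht
    have h2 := h (t + a) (by linarith)
    have h3 : |w * g t| ≤ C := by
      rw [abs_mul]
      nlinarith [abs_nonneg (g t), abs_nonneg w]
    have := abs_sub (w * g t) (g (t + a))
    linarith
  continuous g hg := by
    have : Polynomial.aeval (translation a) (Polynomial.C w - Polynomial.X) g =
        fun t => w * g t - g (t + a) := funext fun t => aeval_translation_factor a w g t
    rw [this]
    fun_prop
  integral_le g hg u v huv := by
    simp only [aeval_translation_factor]
    have hi : ∀ x y : ℝ, IntervalIntegrable (fun t => |g t|) volume x y := fun x y =>
      hg.abs.intervalIntegrable x y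
    have h1 : ∫ t in u..v, |w * g t - g (t + a)| ≤ ∫ t in u..v, (|g t| + |g (t + a)|) := by
      refine intervalIntegral.integral_mono_on huv ?_ ?_ fun t _ => ?_
      · exact Continuous.intervalIntegrable (by fun_prop) _ _
      · exact Continuous.intervalIntegrable (by fun_prop) _ _
      · refine (abs_sub _ _).trans (add_le_add ?_ le_rfl)
        rw [abs_mul]
        exact mul_le_of_le_one_left (abs_nonneg _) hw
    rw [intervalIntegral.integral_add (hi u v) (Continuous.intervalIntegrable (by fun_prop) _ _),
      intervalIntegral.integral_comp_add_right (fun t => |g t|)] at h1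
    have h2 := intervalIntegral.integral_add_adjacent_intervals (hi u v) (hi v (v + a))
    have h3 := intervalIntegral.integral_add_adjacent_intervals (hi u (u + a)) (hi (u + a) (v + a))
    have h4 : 0 ≤ ∫ t in v..(v + a), |g t| :=
      intervalIntegral.integral_nonneg (by linarith) fun t _ => abs_nonneg _
    have h5 : 0 ≤ ∫ t in u..(u + a), |g t| :=
      intervalIntegral.integral_nonneg (by linarith) fun t _ => abs_nonneg _
    rw [Nat.cast_one, one_mul, pow_one]
    linarith

lemma prod {a : ℝ} (ha : 0 ≤ a) (W : Finset ℕ) {w : ℕ → ℝ} (hw : ∀ j, |w j| ≤ 1) :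
    TranslationBound a (∏ j ∈ W, (Polynomial.C (w j) - Polynomial.X)) W.card := by
  induction W using Finset.induction_on with
  | empty => simpa using one a
  | insert j W hj ih =>
    rw [Finset.prod_insert hj, Finset.card_insert_of_notMem hj, add_comm]
    exact (factor ha (hw j)).mul ha ih

lemma pow {a : ℝ} (ha : 0 ≤ a) {w : ℝ} (hw : |w| ≤ 1) (M : ℕ) :
    TranslationBound a ((Polynomial.C w - Polynomial.X) ^ M) M := by
  induction M with
  | zero => simpa using one a
  | succ M ih =>
    rw [pow_succ]
    exact ih.mul ha (factor ha hw)

end TranslationBound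

/-- Differences of order `M` are controlled by derivatives of order `M`. -/
lemma abs_aeval_difference_pow_le {a : ℝ} (ha : 0 ≤ a) (M : ℕ) {F : ℕ → ℝ → ℝ} {C σ : ℝ}
    (hF : ∀ r t, HasDerivAt (F r) (F (r + 1) t) t)
    (hb : ∀ r t, 0 ≤ t → |F r t| ≤ C * σ ^ r) {t : ℝ} (ht : 0 ≤ t) :
    |Polynomial.aeval (translation a) ((Polynomial.C (1 : ℝ) - Polynomial.X) ^ M) (F 0) t| ≤
      C * (a * σ) ^ M := by
  induction M generalizing F C with
  | zero => simpa using hb 0 t ht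
  | succ M ih =>
    rw [pow_succ, map_mul, Module.End.mul_apply]
    have h0 : Polynomial.aeval (translation a) (Polynomial.C (1 : ℝ) - Polynomial.X) (F 0) =
        (fun r t => F r t - F r (t + a)) 0 := by
      ext t
      rw [aeval_translation_factor, one_mul]
    rw [h0]
    refine (ih (F := fun r t => F r t - F r (t + a)) (C := C * (a * σ)) (fun r t => ?_)
      (fun r t ht => ?_)).trans_eq (by ring)
    · exact (hF r t).sub ((hF r (t + a)).comp_add_const t a)
    · have := (convex_Ici (0 : ℝ)).norm_image_sub_le_of_norm_hasDerivWithin_le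
        (fun x _ => (hF r x).hasDerivWithinAt) (fun x hx => hb (r + 1) x hx)
        (x := t + a) (y := t) (Set.mem_Ici.2 (by linarith)) (Set.mem_Ici.2 ht)
      refine this.trans_eq ?_
      rw [Real.norm_eq_abs, show t - (t + a) = -a by ring, abs_neg, abs_of_nonneg ha, pow_succ]
      ring

/-- The polynomial in the translation by `a` that annihilates `exp (-ν_j t)` for `j ∈ W` and
contains a difference of order `M`. -/
noncomputable def annihilator (ν : ℕ → ℝ) (a : ℝ) (W : Finset ℕ) (M : ℕ) : Polynomial ℝ :=
  (∏ j ∈ W, (Polynomial.C (Real.exp (-ν j * a)) - Polynomial.X)) *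
    (Polynomial.C 1 - Polynomial.X) ^ M

lemma abs_exp_neg_mul_le_one {ν : ℕ → ℝ} (hpos : ∀ j, 0 ≤ ν j) {a : ℝ} (ha : 0 ≤ a) (j : ℕ) :
    |Real.exp (-ν j * a)| ≤ 1 := by
  rw [Real.abs_exp, Real.exp_le_one_iff]
  nlinarith [mul_nonneg (hpos j) ha]

lemma translationBound_annihilator {ν : ℕ → ℝ} (hpos : ∀ j, 0 ≤ ν j) {a : ℝ} (ha : 0 ≤ a)
    (W : Finset ℕ) (M : ℕ) : TranslationBound a (annihilator ν a W M) (W.card + M) :=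
  (TranslationBound.prod ha W (abs_exp_neg_mul_le_one hpos ha)).mul ha
    (TranslationBound.pow ha (by simp) M)

lemma abs_aeval_annihilator_le_of_deriv {ν : ℕ → ℝ} (hpos : ∀ j, 0 ≤ ν j) {a : ℝ} (ha : 0 ≤ a)
    (W : Finset ℕ) (M : ℕ) {F : ℕ → ℝ → ℝ} {C σ : ℝ}
    (hF : ∀ r t, HasDerivAt (F r) (F (r + 1) t) t)
    (hb : ∀ r t, 0 ≤ t → |F r t| ≤ C * σ ^ r) {t : ℝ} (ht : 0 ≤ t) :
    |Polynomial.aeval (translation a) (annihilator ν a W M) (F 0) t| ≤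
      2 ^ W.card * (C * (a * σ) ^ M) := by
  rw [annihilator, map_mul, Module.End.mul_apply]
  exact (TranslationBound.prod ha W (abs_exp_neg_mul_le_one hpos ha)).abs_le _ _ 0
    (fun t ht => abs_aeval_difference_pow_le ha M hF hb ht) t ht

lemma eval_annihilator (ν : ℕ → ℝ) (a : ℝ) (W : Finset ℕ) (M : ℕ) (x : ℝ) :
    (annihilator ν a W M).eval x = (∏ j ∈ W, (Real.exp (-ν j * a) - x)) * (1 - x) ^ M := by
  simp [annihilator, Polynomial.eval_prod]

lemma eval_annihilator_of_mem (ν : ℕ → ℝ) (a : ℝ) {W : Finset ℕ} (M : ℕ) {j : ℕ} (hj : j ∈ W) :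
    (annihilator ν a W M).eval (Real.exp (-ν j * a)) = 0 := by
  rw [eval_annihilator, Finset.prod_eq_zero hj (sub_self _), zero_mul]

lemma aeval_translation_hypoExp (ν : ℕ → ℝ) (a : ℝ) (P : Polynomial ℝ) (S : Finset ℕ) (t : ℝ) :
    Polynomial.aeval (translation a) P (hypoExp ν S 0) t =
      ∑ j ∈ S, hypoCoeff ν S j * P.eval (Real.exp (-ν j * a)) * Real.exp (-ν j * t) := by
  have h : hypoExp ν S 0 = ∑ j ∈ S, hypoCoeff ν S j • fun t => Real.exp (-ν j * t) := by
    ext t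
    simp [hypoExp]
  rw [h, map_sum, Finset.sum_apply]
  refine Finset.sum_congr rfl fun j _ => ?_
  rw [map_smul, aeval_translation_exp]
  simp [mul_assoc]

/-! ### Blocks of exponents and the triangular change of basis. -/

/-- The first index of the block of `n`, where consecutive indices are in the same block when the
ratio of the exponents is less than `c`. -/
noncomputable def blockStart (ν : ℕ → ℝ) (c : ℝ) : ℕ → ℕ
  | 0 => 0
  | n + 1 => if ν (n + 1) < c * ν n then blockStart ν c n else n + 1

/-- `s` assigns to each index the first index of its block, for a division of `ℕ` into blocks of at
most `N` consecutive indices, with ratios of the exponents `ν` at most `q` in a block and at least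
`c` between different blocks. -/
structure IsBlockStart (ν : ℕ → ℝ) (c q : ℝ) (N : ℕ) (s : ℕ → ℕ) : Prop where
  le : ∀ n, s n ≤ n
  lt_add : ∀ n, n < s n + N
  eq_of_mem : ∀ n j, s n ≤ j → j ≤ n → s j = s n
  gap : ∀ n j, j < s n → c * ν j ≤ ν (s n)
  le_mul : ∀ n, ν n ≤ q * ν (s n)

lemma isBlockStart_blockStart {ν : ℕ → ℝ} (hν : StrictMono ν) (hpos : ∀ i, 0 < ν i) {c q : ℝ}
    {N : ℕ} (hN : 0 < N) (hc : 1 < c) (hcq : c ^ N = q) (hgrow : ∀ i, q * ν i ≤ ν (i + N)) :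
    IsBlockStart ν c q N (blockStart ν c) := by
  have hle : ∀ n, blockStart ν c n ≤ n := by
    intro n
    induction n with
    | zero => exact le_rfl
    | succ n ih =>
      rw [blockStart]
      split_ifs
      · omega
      · exact le_rfl
  have heq : ∀ n j, blockStart ν c n ≤ j → j ≤ n → blockStart ν c j = blockStart ν c n := by
    intro n
    induction n with
    | zero => intro j _ hj; rw [Nat.le_zero.1 hj]
    | succ n ih =>
      intro j h1 h2
      rcases h2.eq_or_lt with rfl | h2
      · rfl
      · rw [blockStart] at h1 ⊢
        split_ifs at h1 ⊢ with h
        · exact ih j h1 (by omega)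
        · omega
  -- The strict inequality away from the start of the block is what limits its length: at distance
  -- `N` it would contradict the growth hypothesis, because `c ^ N = q`.
  have hlt : ∀ n, ν n ≤ c ^ (n - blockStart ν c n) * ν (blockStart ν c n) ∧
      (blockStart ν c n < n → ν n < c ^ (n - blockStart ν c n) * ν (blockStart ν c n)) := by
    intro n
    induction n with
    | zero => simp [blockStart]
    | succ n ih =>
      rw [blockStart]
      split_ifs with h
      · have h1 : ν (n + 1) < c ^ (n + 1 - blockStart ν c n) * ν (blockStart ν c n) := by
          rw [Nat.succ_sub (hle n), pow_succ]
          nlinarith [ih.1]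
        exact ⟨h1.le, fun _ => h1⟩
      · simp
  have hN' : ∀ n, n < blockStart ν c n + N := by
    intro n
    by_contra! h
    have h1 := heq n (blockStart ν c n + N) (by omega) h
    have h2 := (hlt (blockStart ν c n + N)).2 (by omega)
    rw [h1, Nat.add_sub_cancel_left, hcq] at h2
    exact absurd (hgrow (blockStart ν c n)) (not_le.2 h2)
  refine ⟨hle, hN', heq, ?_, fun n => ?_⟩
  · intro n
    induction n with
    | zero => intro j hj; exact absurd hj (Nat.not_lt_zero j)
    | succ n ih =>
      intro j
      rw [blockStart]
      split_ifs with h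
      · exact ih j
      · intro hj
        have := hν.monotone (Nat.lt_succ_iff.1 hj)
        nlinarith
  · refine (hlt n).1.trans (mul_le_mul_of_nonneg_right ?_ (hpos _).le)
    rw [← hcq]
    have := hN' n
    exact pow_le_pow_right₀ hc.le (by omega)

lemma pow_mul_le_of_growth {ν : ℕ → ℝ} (hν : StrictMono ν) (hpos : ∀ i, 0 < ν i) {c q : ℝ}
    {N : ℕ} (hN : 0 < N) (hc : 1 < c) (hcq : c ^ N = q) (hgrow : ∀ i, q * ν i ≤ ν (i + N))
    (l m : ℕ) : c ^ m * ν l ≤ q * ν (l + m) := by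
  have hc0 : 0 < c := by linarith
  induction m using Nat.strong_induction_on with
  | _ m ih =>
    rcases lt_or_ge m N with h | h
    · rw [← hcq]
      exact mul_le_mul (pow_le_pow_right₀ hc.le h.le) (hν.monotone (Nat.le_add_right _ _))
        (hpos l).le (by positivity)
    · obtain ⟨k, rfl⟩ := Nat.exists_eq_add_of_le' h
      have h1 := ih k (by omega)
      have h2 := hgrow (l + k)
      rw [pow_add, hcq, ← add_assoc]
      have hq : 0 < q := hcq ▸ pow_pos hc0 N
      nlinarith

/-- The hypoexponential function attached to the part of the block of `n` up to `n`. -/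
noncomputable def blockExp (ν : ℕ → ℝ) (s : ℕ → ℕ) (n : ℕ) : ℝ → ℝ :=
  hypoExp ν (Finset.Icc (s n) n) 0

lemma hypoCoeff_ne_zero {ν : ℕ → ℝ} (hν : Function.Injective ν) (hpos : ∀ i, 0 < ν i)
    (S : Finset ℕ) (j : ℕ) : hypoCoeff ν S j ≠ 0 :=
  Finset.prod_ne_zero_iff.2 fun i hi => div_ne_zero (hpos i).ne'
    (sub_ne_zero.2 fun h => (Finset.ne_of_mem_erase hi) (hν h))

/-- The change of basis is triangular with nonzero diagonal `hypoCoeff ν S n`: subtracting a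
multiple of the function of index `n` removes the top exponential and alters only earlier
coefficients. -/
lemma exists_blockExp_expansion {ν : ℕ → ℝ} (hν : Function.Injective ν) (hpos : ∀ i, 0 < ν i)
    {s : ℕ → ℕ} (hs : ∀ n, s n ≤ n) (n₀ : ℕ) (a : ℕ → ℝ) :
    ∃ b : ℕ → ℝ, ∀ t, ∑ i ∈ Finset.range n₀, a i * Real.exp (-ν i * t) =
      ∑ n ∈ Finset.range n₀, b n * blockExp ν s n t := by
  induction n₀ generalizing a with
  | zero => exact ⟨0, fun t => by simp⟩
  | succ n ih =>
    set S := Finset.Icc (s n) n with hS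
    have hd := hypoCoeff_ne_zero hν hpos S n
    obtain ⟨b, hb⟩ := ih fun i => a i - if i ∈ S then a n / hypoCoeff ν S n * hypoCoeff ν S i else 0
    refine ⟨fun i => if i = n then a n / hypoCoeff ν S n else b i, fun t => ?_⟩
    rw [Finset.sum_range_succ, Finset.sum_range_succ]
    beta_reduce
    rw [if_pos rfl]
    have h1 : ∑ i ∈ Finset.range n, (if i = n then a n / hypoCoeff ν S n else b i) *
        blockExp ν s i t = ∑ i ∈ Finset.range n, b i * blockExp ν s i t :=
      Finset.sum_congr rfl fun i hi => by rw [if_neg (Finset.mem_range.1 hi).ne]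
    have h2 : blockExp ν s n t = hypoCoeff ν S n * Real.exp (-ν n * t) +
        ∑ i ∈ Finset.range n, if i ∈ S then hypoCoeff ν S i * Real.exp (-ν i * t) else 0 := by
      rw [← Finset.sum_filter]
      have : (Finset.range n).filter (· ∈ S) = S.erase n := by
        ext i
        simp only [hS, Finset.mem_filter, Finset.mem_range, Finset.mem_Icc, Finset.mem_erase]
        omega
      rw [this, Finset.add_sum_erase S (fun i => hypoCoeff ν S i * Real.exp (-ν i * t))
        (Finset.mem_Icc.2 ⟨hs n, le_rfl⟩)]
      simp [blockExp, hypoExp, hS]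
    have h3 : ∑ i ∈ Finset.range n, (a i - if i ∈ S then a n / hypoCoeff ν S n * hypoCoeff ν S i
        else 0) * Real.exp (-ν i * t) = ∑ i ∈ Finset.range n, a i * Real.exp (-ν i * t) -
        a n / hypoCoeff ν S n * ∑ i ∈ Finset.range n,
          if i ∈ S then hypoCoeff ν S i * Real.exp (-ν i * t) else 0 := by
      rw [Finset.mul_sum, ← Finset.sum_sub_distrib]
      refine Finset.sum_congr rfl fun i _ => ?_
      split_ifs <;> ring
    rw [h1, ← hb, h2, h3, mul_add, ← mul_assoc, div_mul_cancel₀ _ hd]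
    abel

/-! ### Extraction of one coefficient. -/

/-- The indices to be annihilated when the coefficient of index `n` is extracted. -/
def annihilationWindow (s : ℕ → ℕ) (N H n : ℕ) : Finset ℕ :=
  Finset.Ico (n - (H + N)) n ∪ (Finset.Ioc n (n + H)).filter fun j => n < s j

lemma mem_annihilationWindow {s : ℕ → ℕ} {N H n j : ℕ} :
    j ∈ annihilationWindow s N H n ↔
      (n - (H + N) ≤ j ∧ j < n) ∨ (n < j ∧ j ≤ n + H) ∧ n < s j := by
  simp [annihilationWindow]

lemma card_annihilationWindow_le (s : ℕ → ℕ) (N H n : ℕ) :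
    (annihilationWindow s N H n).card ≤ 2 * H + N := by
  refine (Finset.card_union_le _ _).trans ?_
  have := Finset.card_filter_le (Finset.Ioc n (n + H)) fun j => n < s j
  simp only [Nat.card_Ico, Nat.card_Ioc] at this ⊢
  omega

/-- The lower margin `H + N` is needed because a block may start up to `N - 1` places before `l`,
and all its exponentials occur in the function of index `l`. -/
lemma block_subset_annihilationWindow {ν : ℕ → ℝ} {c q : ℝ} {N : ℕ} {s : ℕ → ℕ}
    (hs : IsBlockStart ν c q N s) {H n l : ℕ} (hl : l ≠ n) (h1 : n ≤ l + H) (h2 : l ≤ n + H)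
    (h3 : n < l → n < s l) : Finset.Icc (s l) l ⊆ annihilationWindow s N H n := by
  intro j hj
  rw [Finset.mem_Icc] at hj
  have hj' := hs.eq_of_mem l j hj.1 hj.2
  have := hs.lt_add l
  rw [mem_annihilationWindow, hj']
  rcases lt_or_gt_of_ne hl with h | h
  · left; omega
  · right; have := h3 h; omega

lemma aeval_annihilator_blockExp_eq_zero {ν : ℕ → ℝ} {c q : ℝ} {N : ℕ} {s : ℕ → ℕ}
    (hs : IsBlockStart ν c q N s) {H n l : ℕ} (hl : l ≠ n) (h1 : n ≤ l + H) (h2 : l ≤ n + H)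
    (h3 : n < l → n < s l) (a : ℝ) (M : ℕ) (t : ℝ) :
    Polynomial.aeval (translation a) (annihilator ν a (annihilationWindow s N H n) M)
      (blockExp ν s l) t = 0 := by
  rw [blockExp, aeval_translation_hypoExp]
  refine Finset.sum_eq_zero fun j hj => ?_
  rw [eval_annihilator_of_mem ν a M (block_subset_annihilationWindow hs hl h1 h2 h3 hj)]
  ring

/-- Each small factor `exp (-ν_j a) - exp (-ν_n a)` with `j` earlier in the block is paired with the
coefficient factor `ν_j / (ν_j - ν_n)`, which compensates it. Later indices of the block have no
such partner, so the window omits them. -/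
lemma aeval_annihilator_blockExp_self {ν : ℕ → ℝ} {c q : ℝ} {N : ℕ} {s : ℕ → ℕ}
    (hs : IsBlockStart ν c q N s) (H n : ℕ) (a : ℝ) (M : ℕ) (t : ℝ) :
    Polynomial.aeval (translation a) (annihilator ν a (annihilationWindow s N H n) M)
      (blockExp ν s n) t = (∏ j ∈ annihilationWindow s N H n,
        (Real.exp (-ν j * a) - Real.exp (-ν n * a)) *
          if s n ≤ j ∧ j < n then ν j / (ν j - ν n) else 1) * (1 - Real.exp (-ν n * a)) ^ M *
            Real.exp (-ν n * t) := by
  have hlt := hs.lt_add n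
  have hn : n ∈ Finset.Icc (s n) n := Finset.mem_Icc.2 ⟨hs.le n, le_rfl⟩
  rw [blockExp, aeval_translation_hypoExp, Finset.sum_eq_single_of_mem n hn]
  · congr 1
    rw [eval_annihilator, Finset.prod_mul_distrib, ← Finset.prod_filter, hypoCoeff]
    have : (annihilationWindow s N H n).filter (fun j => s n ≤ j ∧ j < n) =
        (Finset.Icc (s n) n).erase n := by
      ext j
      simp only [Finset.mem_filter, mem_annihilationWindow, Finset.mem_erase, Finset.mem_Icc]
      omega
    rw [this]
    ring
  · intro j hj hjn
    rw [Finset.mem_Icc] at hj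
    rw [eval_annihilator_of_mem ν a M]
    · ring
    · rw [mem_annihilationWindow]; omega

lemma abs_exp_neg_sub_exp_neg_one_ge_of_le {c x : ℝ} (hx : c ≤ x) :
    Real.exp (-1) - Real.exp (-c) ≤ |Real.exp (-x) - Real.exp (-1)| := by
  rw [abs_sub_comm]
  refine le_trans ?_ (le_abs_self _)
  have := Real.exp_le_exp.2 (neg_le_neg hx)
  linarith

lemma abs_exp_neg_sub_exp_neg_one_ge_of_ge {d x : ℝ} (hx : x ≤ d) :
    Real.exp (-d) - Real.exp (-1) ≤ |Real.exp (-x) - Real.exp (-1)| := by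
  refine le_trans ?_ (le_abs_self _)
  have := Real.exp_le_exp.2 (neg_le_neg hx)
  linarith

/-- With `a = 1 / ν_n` every factor depends on `ν_j / ν_n` only. In other blocks this ratio is at
most `1 / c` or at least `c`; in the same block the paired product is at least `exp (-1) / q`. So
`γ` depends on `c` and `q` alone. -/
lemma exists_le_abs_aeval_annihilator_blockExp_self {c q : ℝ} (hc : 1 < c) (hq : 1 ≤ q) :
    ∃ γ : ℝ, 0 < γ ∧ γ ≤ 1 ∧ ∀ {ν : ℕ → ℝ} {N : ℕ} {s : ℕ → ℕ}, StrictMono ν → (∀ i, 0 < ν i) →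
      IsBlockStart ν c q N s → ∀ H M n t,
      γ ^ (2 * H + N + M) * Real.exp (-ν n * t) ≤
        |Polynomial.aeval (translation (ν n)⁻¹)
          (annihilator ν (ν n)⁻¹ (annihilationWindow s N H n) M) (blockExp ν s n) t| := by
  have hc0 : 0 < c := by linarith
  have h1 : 0 < Real.exp (-1) - Real.exp (-c) := sub_pos.2 (Real.exp_lt_exp.2 (by linarith))
  have h2 : 0 < Real.exp (-c⁻¹) - Real.exp (-1) :=
    sub_pos.2 (Real.exp_lt_exp.2 (by have := inv_lt_one_of_one_lt₀ hc; linarith))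
  have h3 : 0 < 1 - Real.exp (-1) := sub_pos.2 (by rw [Real.exp_lt_one_iff]; norm_num)
  have h4 : 0 < Real.exp (-1) / q := by positivity
  obtain ⟨γ, hγ0, hγ1, hγ2, hγ3, hγ4⟩ : ∃ γ : ℝ, 0 < γ ∧ γ ≤ Real.exp (-1) - Real.exp (-c) ∧
      γ ≤ Real.exp (-c⁻¹) - Real.exp (-1) ∧ γ ≤ 1 - Real.exp (-1) ∧ γ ≤ Real.exp (-1) / q :=
    ⟨min (min (Real.exp (-1) - Real.exp (-c)) (Real.exp (-c⁻¹) - Real.exp (-1)))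
      (min (1 - Real.exp (-1)) (Real.exp (-1) / q)), by simp only [lt_min_iff]; tauto,
      (min_le_left _ _).trans (min_le_left _ _), (min_le_left _ _).trans (min_le_right _ _),
      (min_le_right _ _).trans (min_le_left _ _), (min_le_right _ _).trans (min_le_right _ _)⟩
  have hγ5 : γ ≤ 1 := hγ3.trans (by have := Real.exp_pos (-1); linarith)
  refine ⟨γ, hγ0, hγ5, fun {ν N s} hν hpos hs H M n t => ?_⟩
  have hn := hpos n
  rw [aeval_annihilator_blockExp_self hs, abs_mul, Real.abs_exp]
  refine mul_le_mul_of_nonneg_right ?_ (Real.exp_pos _).le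
  have hnn : -ν n * (ν n)⁻¹ = -1 := by field_simp
  rw [hnn, abs_mul, abs_pow, abs_of_pos h3, Finset.abs_prod, pow_add]
  refine mul_le_mul ?_ (pow_le_pow_left₀ hγ0.le hγ3 _) (by positivity)
    (Finset.prod_nonneg fun j _ => abs_nonneg _)
  refine (pow_le_pow_of_le_one hγ0.le hγ5 (card_annihilationWindow_le s N H n)).trans ?_
  rw [← Finset.prod_const]
  refine Finset.prod_le_prod (fun _ _ => hγ0.le) fun j hj => ?_
  rw [mem_annihilationWindow] at hj
  have hx : -ν j * (ν n)⁻¹ = -(ν j / ν n) := by rw [neg_mul, div_eq_mul_inv]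
  rw [hx]
  split_ifs with hb
  · have hjn := hν hb.2
    have hx1 : ν j / ν n < 1 := (div_lt_one hn).2 hjn
    have hq' : ν n ≤ q * ν j := (hs.le_mul n).trans
      (mul_le_mul_of_nonneg_left (hν.monotone hb.1) (by linarith))
    have hE : Real.exp (-1) * (1 - ν j / ν n) ≤ Real.exp (-(ν j / ν n)) - Real.exp (-1) := by
      have e1 := Real.add_one_le_exp (1 - ν j / ν n)
      have e2 : Real.exp (-(ν j / ν n)) = Real.exp (-1) * Real.exp (1 - ν j / ν n) := by
        rw [← Real.exp_add]; ring_nf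
      rw [e2]
      nlinarith [Real.exp_pos (-1)]
    rw [abs_mul, abs_div, abs_of_pos (hpos j), abs_sub_comm (ν j), abs_of_pos (sub_pos.2 hjn)]
    refine hγ4.trans ?_
    have e3 : Real.exp (-1) / q ≤ Real.exp (-1) * (1 - ν j / ν n) * (ν j / (ν n - ν j)) := by
      have : Real.exp (-1) * (1 - ν j / ν n) * (ν j / (ν n - ν j)) =
          Real.exp (-1) * (ν j / ν n) := by
        have := (sub_pos.2 hjn).ne'
        field_simp
      rw [this, div_eq_mul_inv]
      refine mul_le_mul_of_nonneg_left ?_ (Real.exp_pos _).le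
      rw [inv_le_comm₀ (by linarith) (div_pos (hpos j) hn), inv_div, div_le_iff₀ (hpos j)]
      exact hq'
    exact e3.trans (mul_le_mul_of_nonneg_right (hE.trans (le_abs_self _))
      (div_nonneg (hpos j).le (sub_pos.2 hjn).le))
  · rw [mul_one]
    rcases hj with hj | ⟨hj, hj'⟩
    · have hjs : j < s n := by omega
      have := (hs.gap n j hjs).trans (hν.monotone (hs.le n))
      refine hγ2.trans (abs_exp_neg_sub_exp_neg_one_ge_of_ge ?_)
      rw [div_le_iff₀ hn, le_inv_mul_iff₀ hc0]
      exact this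
    · have := (hs.gap j n hj').trans (hν.monotone (hs.le j))
      refine hγ1.trans (abs_exp_neg_sub_exp_neg_one_ge_of_le ?_)
      rwa [le_div_iff₀ hn]

/-- Giving up the factor `ν 0 > 1` in the decay rate makes `B = ν 0 / (ν 0 - 1)` work for all rates
in all blocks, while the rate `ν (s l) / ν 0` is still at least 1. -/
lemma abs_blockExp_le {ν : ℕ → ℝ} (hν : StrictMono ν) (h0 : 1 < ν 0) {c q : ℝ} {N : ℕ}
    {s : ℕ → ℕ} (hs : IsBlockStart ν c q N s) (l : ℕ) {t : ℝ} (ht : 0 ≤ t) :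
    |blockExp ν s l t| ≤ (ν 0 / (ν 0 - 1)) ^ N * Real.exp (-(ν (s l) / ν 0) * t) := by
  have hB : 1 ≤ ν 0 / (ν 0 - 1) := by rw [le_div_iff₀ (by linarith)]; linarith
  have hmono : ∀ j, ν 0 ≤ ν j := fun j => hν.monotone (Nat.zero_le j)
  refine (abs_hypoExp_le (κ := ν (s l) / ν 0) hν.injective hB _
    (fun j _ => by linarith [hmono j]) (fun j hj => ?_) ht).trans ?_
  · have h1 : ν (s l) ≤ ν j := hν.monotone (Finset.mem_Icc.1 hj).1
    have h2 : ν 0 - 1 > 0 := by linarith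
    rw [div_mul_eq_mul_div, le_div_iff₀ h2, mul_sub, mul_sub, mul_div_cancel₀ _ (by linarith)]
    nlinarith
  · refine mul_le_mul_of_nonneg_right (pow_le_pow_right₀ hB ?_) (Real.exp_pos _).le
    have := hs.lt_add l
    rw [Nat.card_Icc]
    omega

lemma abs_blockExp_le_one {ν : ℕ → ℝ} (hν : Function.Injective ν) (hpos : ∀ i, 0 < ν i)
    (s : ℕ → ℕ) (l : ℕ) {t : ℝ} (ht : 0 ≤ t) : |blockExp ν s l t| ≤ 1 := by
  simpa [blockExp] using abs_hypoExp_le hν (κ := 0) le_rfl _ (fun j _ => (hpos j).le) (fun j _ => by simp) ht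

/-! ### Leakage between indices, and the resulting coefficient bounds. -/

/-- The influence of the coefficient of index `l` on the extraction of the coefficient of
index `n`. -/
noncomputable def leakage (ν : ℕ → ℝ) (s : ℕ → ℕ) (q : ℝ) (N H M n l : ℕ) : ℝ :=
  if n < l ∧ s l ≤ n then 1
  else if l + H < n then (2 * (ν l / ν n)) ^ M
  else if n + H < l then (ν 0 / (ν 0 - 1)) ^ N * Real.exp (-(ν l / ν n / (q * ν 0)))
  else 0

lemma abs_aeval_annihilator_blockExp_le {ν : ℕ → ℝ} (hν : StrictMono ν) (h0 : 1 < ν 0) {c q : ℝ}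
    {N : ℕ} {s : ℕ → ℕ} (hq : 1 ≤ q) (hs : IsBlockStart ν c q N s) (H M : ℕ) {n l : ℕ} (hl : l ≠ n)
    {t : ℝ} (ht : (ν n)⁻¹ ≤ t) :
    |Polynomial.aeval (translation (ν n)⁻¹)
      (annihilator ν (ν n)⁻¹ (annihilationWindow s N H n) M) (blockExp ν s l) t| ≤
      2 ^ (2 * H + N + M) * leakage ν s q N H M n l := by
  have hpos : ∀ j, 0 < ν j := fun j => by linarith [hν.monotone (Nat.zero_le j)]
  have hpos' : ∀ j, 0 ≤ ν j := fun j => (hpos j).le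
  have ha : 0 ≤ (ν n)⁻¹ := (inv_pos.2 (hpos n)).le
  have hW := card_annihilationWindow_le s N H n
  have hT := translationBound_annihilator hpos' ha (annihilationWindow s N H n) M
  have h2 : (2 : ℝ) ^ ((annihilationWindow s N H n).card + M) ≤ 2 ^ (2 * H + N + M) :=
    pow_le_pow_right₀ one_le_two (by omega)
  unfold leakage
  split_ifs with hb hlow hhigh
  · exact (hT.abs_le _ 1 0 (fun t ht => abs_blockExp_le_one hν.injective hpos s l ht) t
      (ha.trans ht)).trans (mul_le_mul_of_nonneg_right h2 zero_le_one)
  · refine (abs_aeval_annihilator_le_of_deriv hpos' ha _ M (C := 1) (σ := 2 * ν l)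
      (hasDerivAt_hypoExp ν (Finset.Icc (s l) l)) (fun r t ht => ?_) (ha.trans ht)).trans ?_
    · rw [one_mul]
      exact abs_hypoExp_deriv_le hν.injective (hpos' l) r _
        (fun j hj => ⟨hpos' j, hν.monotone (Finset.mem_Icc.1 hj).2⟩) ht
    · rw [one_mul, show (ν n)⁻¹ * (2 * ν l) = 2 * (ν l / ν n) by ring]
      have := div_nonneg (hpos' l) (hpos' n)
      exact mul_le_mul_of_nonneg_right (pow_le_pow_right₀ one_le_two (by omega)) (by positivity)
  · refine (hT.abs_le _ ((ν 0 / (ν 0 - 1)) ^ N * Real.exp (-(ν l / ν n / (q * ν 0)))) (ν n)⁻¹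
      (fun t ht => (abs_blockExp_le hν h0 hs l (ha.trans ht)).trans ?_) t ht).trans ?_
    · have hB : 0 ≤ ν 0 / (ν 0 - 1) := div_nonneg (hpos' 0) (by linarith)
      refine mul_le_mul_of_nonneg_left (Real.exp_le_exp.2 ?_) (by positivity)
      rw [neg_mul, neg_le_neg_iff]
      have e1 : ν (s l) / ν 0 * (ν n)⁻¹ ≤ ν (s l) / ν 0 * t :=
        mul_le_mul_of_nonneg_left ht (div_nonneg (hpos' _) (hpos' _))
      refine le_trans ?_ e1
      have e2 := hs.le_mul l
      have := hpos n
      have := hpos 0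
      have hq0 : 0 < q := by linarith
      rw [div_div, div_le_iff₀ (by positivity)]
      calc ν l ≤ q * ν (s l) := e2
        _ = _ := by field_simp
    · have hB : 0 ≤ ν 0 / (ν 0 - 1) := div_nonneg (hpos' 0) (by linarith)
      exact mul_le_mul_of_nonneg_right h2 (by positivity)
  · rw [aeval_annihilator_blockExp_eq_zero hs hl (by omega) (by omega) (fun h => by
      by_contra h'; exact hb ⟨h, by omega⟩)]
    simp

lemma leakage_self (ν : ℕ → ℝ) (s : ℕ → ℕ) (q : ℝ) (N H M n : ℕ) :
    leakage ν s q N H M n n = 0 := by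
  simp [leakage]

/-- Bound for a coefficient at a point of `[1 / ν_n, 2 / ν_n]`. -/
lemma abs_coeff_le_of_expansion {ν : ℕ → ℝ} (hν : StrictMono ν) (h0 : 1 < ν 0) {c q : ℝ}
    {N : ℕ} {s : ℕ → ℕ} (hq : 1 ≤ q) (hs : IsBlockStart ν c q N s) {H M : ℕ} {γ : ℝ} (hγ : 0 < γ)
    {n : ℕ} (hγn : ∀ t, γ ^ (2 * H + N + M) * Real.exp (-ν n * t) ≤
        |Polynomial.aeval (translation (ν n)⁻¹)
          (annihilator ν (ν n)⁻¹ (annihilationWindow s N H n) M) (blockExp ν s n) t|)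
    {n₀ : ℕ} (hn : n < n₀) (b : ℕ → ℝ) {f : ℝ → ℝ}
    (hf : ∀ t, f t = ∑ l ∈ Finset.range n₀, b l * blockExp ν s l t)
    {t : ℝ} (ht1 : (ν n)⁻¹ ≤ t) (ht2 : t ≤ 2 * (ν n)⁻¹) :
    |b n| ≤ Real.exp 2 * (2 / γ) ^ (2 * H + N + M) *
      (|Polynomial.aeval (translation (ν n)⁻¹)
          (annihilator ν (ν n)⁻¹ (annihilationWindow s N H n) M) f t| +
        ∑ l ∈ Finset.range n₀, leakage ν s q N H M n l * |b l|) := by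
  have hpos : ∀ j, 0 < ν j := fun j => by linarith [hν.monotone (Nat.zero_le j)]
  set D := 2 * H + N + M
  set T := Polynomial.aeval (translation (ν n)⁻¹)
    (annihilator ν (ν n)⁻¹ (annihilationWindow s N H n) M) with hT
  have hf' : f = ∑ l ∈ Finset.range n₀, b l • blockExp ν s l := by
    ext t
    simp [hf]
  have hTf : T f t = ∑ l ∈ Finset.range n₀, b l * T (blockExp ν s l) t := by
    rw [hf', map_sum, Finset.sum_apply]
    exact Finset.sum_congr rfl fun l _ => by rw [map_smul]; rfl
  rw [← Finset.add_sum_erase _ _ (Finset.mem_range.2 hn)] at hTf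
  have h1 : |b n| * |T (blockExp ν s n) t| ≤
      |T f t| + ∑ l ∈ (Finset.range n₀).erase n, |b l| * |T (blockExp ν s l) t| := by
    rw [← abs_mul]
    have e1 : b n * T (blockExp ν s n) t =
      T f t - ∑ l ∈ (Finset.range n₀).erase n, b l * T (blockExp ν s l) t := by linarith
    rw [e1]
    refine (abs_sub _ _).trans (add_le_add le_rfl ((Finset.abs_sum_le_sum_abs _ _).trans_eq ?_))
    exact Finset.sum_congr rfl fun l _ => abs_mul _ _
  have h2 : ∑ l ∈ (Finset.range n₀).erase n, |b l| * |T (blockExp ν s l) t| ≤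
      2 ^ D * ∑ l ∈ Finset.range n₀, leakage ν s q N H M n l * |b l| := by
    rw [Finset.mul_sum, ← Finset.add_sum_erase _ _ (Finset.mem_range.2 hn), leakage_self, zero_mul,
      mul_zero, zero_add]
    refine Finset.sum_le_sum fun l hl => ?_
    have := abs_aeval_annihilator_blockExp_le hν h0 hq hs H M (Finset.ne_of_mem_erase hl) ht1
    rw [← mul_assoc, mul_comm]
    exact mul_le_mul_of_nonneg_right this (abs_nonneg _)
  -- The upper limit `t ≤ 2 / ν_n` enters here: it keeps `exp (-ν_n t)` at least `exp (-2)`.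
  have h3 : γ ^ D * Real.exp (-2) ≤ |T (blockExp ν s n) t| := by
    refine le_trans ?_ (hγn t)
    refine mul_le_mul_of_nonneg_left (Real.exp_le_exp.2 ?_) (by positivity)
    have := mul_le_mul_of_nonneg_left ht2 (hpos n).le
    have e : ν n * (2 * (ν n)⁻¹) = 2 := by have := (hpos n).ne'; field_simp
    rw [e] at this
    linarith
  have h4 : |T f t| ≤ 2 ^ D * |T f t| :=
    le_mul_of_one_le_left (abs_nonneg _) (one_le_pow₀ one_le_two)
  have h5 : |b n| * (γ ^ D * Real.exp (-2)) ≤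
      2 ^ D * (|T f t| + ∑ l ∈ Finset.range n₀, leakage ν s q N H M n l * |b l|) := by
    have := mul_le_mul_of_nonneg_left h3 (abs_nonneg (b n))
    linarith
  rw [Real.exp_neg] at h5
  rw [div_pow]
  have h6 := Real.exp_pos 2
  have h7 : 0 < γ ^ D := by positivity
  calc |b n| = |b n| * (γ ^ D * (Real.exp 2)⁻¹) * (Real.exp 2 / γ ^ D) := by field_simp
    _ ≤ _ := mul_le_mul_of_nonneg_right h5 (by positivity)
    _ = _ := by ring

/-- The prefactor grows with the window like `A ^ (2 (N + 1) H)`. Hence `M` is fixed first, so that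
`A ^ (2 (N + 1)) * c⁻¹ ^ (M + 1) < 1`; every factor depending on `M` is then constant, and `H` is
taken large. -/
lemma exists_difference_order_and_window {A c E P : ℝ} (hA : 0 < A) (hc : 1 < c) (N : ℕ)
    (Q : ℕ → ℝ) : ∃ M H : ℕ, P * (E * A ^ (2 * H + N + M)) ^ (N + 1) * Q M *
      ((c⁻¹) ^ (M + 1)) ^ H / (1 - (c⁻¹) ^ (M + 1)) ≤ 1 / 8 := by
  have hc1 : c⁻¹ < 1 := inv_lt_one_of_one_lt₀ hc
  have hc0 : 0 < c⁻¹ := inv_pos.2 (by linarith)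
  obtain ⟨M, hM⟩ := exists_pow_lt_of_lt_one (inv_pos.2 (pow_pos hA (2 * (N + 1)))) hc1
  set r := (c⁻¹) ^ (M + 1)
  have hr : A ^ (2 * (N + 1)) * r < 1 := by
    have h1 : r ≤ (c⁻¹) ^ M := pow_le_pow_of_le_one hc0.le hc1.le (Nat.le_succ M)
    have h2 : 0 < A ^ (2 * (N + 1)) := by positivity
    calc A ^ (2 * (N + 1)) * r < A ^ (2 * (N + 1)) * (A ^ (2 * (N + 1)))⁻¹ :=
          mul_lt_mul_of_pos_left (h1.trans_lt hM) h2
      _ = 1 := mul_inv_cancel₀ h2.ne'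
  have hr0 : 0 ≤ A ^ (2 * (N + 1)) * r := by positivity
  have hlim := (tendsto_pow_atTop_nhds_zero_of_lt_one hr0 hr).const_mul
    (P * (E * A ^ (N + M)) ^ (N + 1) * Q M / (1 - r))
  rw [mul_zero] at hlim
  obtain ⟨H, hH⟩ := (hlim.eventually_le_const (show (0 : ℝ) < 1 / 8 by norm_num)).exists
  refine ⟨M, H, le_trans (le_of_eq ?_) hH⟩
  change P * (E * A ^ (2 * H + N + M)) ^ (N + 1) * Q M * r ^ H / (1 - r) = _
  clear_value r
  have hAH : (A ^ (2 * (N + 1))) ^ H = (A ^ (2 * H)) ^ (N + 1) := by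
    rw [← pow_mul, ← pow_mul]; ring_nf
  rw [mul_pow _ r, hAH, show 2 * H + N + M = 2 * H + (N + M) by ring, pow_add A, mul_left_comm E, mul_pow]
  ring

/-- The constant in the geometric decay of the leakage. -/
noncomputable def leakageConst (x₀ q : ℝ) (N M : ℕ) : ℝ :=
  q ^ (M + 1) * (2 ^ M + (x₀ / (x₀ - 1)) ^ N * ((M + 2).factorial * (q * x₀) ^ (M + 2)))

lemma exp_neg_inv_le {x : ℝ} (hx : 0 < x) (k : ℕ) : Real.exp (-x⁻¹) ≤ k.factorial * x ^ k := by
  have h := Real.pow_div_factorial_le_exp x⁻¹ (inv_pos.2 hx).le k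
  rw [Real.exp_neg, inv_le_comm₀ (Real.exp_pos _) (by positivity), mul_inv, ← inv_pow, mul_comm]
  exact h

lemma leakageConst_nonneg {x₀ q : ℝ} (h0 : 1 < x₀) (hq : 1 ≤ q) (N M : ℕ) :
    0 ≤ leakageConst x₀ q N M := by
  have hB : 0 ≤ x₀ / (x₀ - 1) := div_nonneg (by linarith) (by linarith)
  unfold leakageConst
  positivity

/-- Replacing the normalisation `1 / ν_n` by `1 / ν_l` multiplies by `ν_l / ν_n`. For small `l` this
raises the power `M` to `M + 1`; for large `l` it costs one power, so the exponential is bounded by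
a power of order `M + 2`; inside a block it costs at most `q`. -/
lemma leakage_div_le {ν : ℕ → ℝ} (hν : StrictMono ν) (h0 : 1 < ν 0) {c q : ℝ} {N : ℕ}
    {s : ℕ → ℕ} (hq : 1 ≤ q) (hc : 1 < c) (hs : IsBlockStart ν c q N s)
    (hgrow : ∀ l m, c ^ m * ν l ≤ q * ν (l + m)) (H M n l : ℕ) :
    leakage ν s q N H M n l / ν n ≤
      (if n < l ∧ s l ≤ n then q
        else if l + H < n then leakageConst (ν 0) q N M * ((c⁻¹) ^ (M + 1)) ^ (n - l)
        else if n + H < l then leakageConst (ν 0) q N M * ((c⁻¹) ^ (M + 1)) ^ (l - n)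
        else 0) / ν l := by
  have hpos : ∀ j, 0 < ν j := fun j => by linarith [hν.monotone (Nat.zero_le j)]
  have hn := hpos n
  have hl := hpos l
  have h00 := hpos 0
  have hB : 0 ≤ ν 0 / (ν 0 - 1) := div_nonneg h00.le (by linarith)
  have hratio : ∀ l m, l ≤ m → ν l / ν m ≤ q * (c⁻¹) ^ (m - l) := fun l m hlm => by
    have := hgrow l (m - l)
    rw [Nat.add_sub_cancel' hlm] at this
    rw [inv_pow, ← div_eq_mul_inv, div_le_div_iff₀ (hpos m) (by positivity), mul_comm]
    exact this
  have hratio' : ∀ l m, l ≤ m →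
      (ν l / ν m) ^ (M + 1) ≤ q ^ (M + 1) * ((c⁻¹) ^ (M + 1)) ^ (m - l) := fun l m hlm => by
    rw [← pow_mul, mul_comm (M + 1), pow_mul, ← mul_pow]
    exact pow_le_pow_left₀ (div_nonneg (hpos l).le (hpos m).le) (hratio l m hlm) _
  rw [div_le_div_iff₀ hn hl]
  unfold leakage
  split_ifs with h1 h2 h3
  · rw [one_mul]
    exact (hs.le_mul l).trans (mul_le_mul_of_nonneg_left (hν.monotone h1.2) (by linarith))
  · rw [← div_le_iff₀ hn]
    have h4 := hratio' l n (by omega)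
    calc (2 * (ν l / ν n)) ^ M * ν l / ν n = 2 ^ M * (ν l / ν n) ^ (M + 1) := by
          rw [mul_pow, pow_succ]; ring
      _ ≤ 2 ^ M * (q ^ (M + 1) * ((c⁻¹) ^ (M + 1)) ^ (n - l)) :=
          mul_le_mul_of_nonneg_left h4 (by positivity)
      _ ≤ _ := by
          unfold leakageConst
          rw [← mul_assoc, mul_comm (2 ^ M)]
          refine mul_le_mul_of_nonneg_right ?_ (by positivity)
          refine mul_le_mul_of_nonneg_left ?_ (by positivity)
          exact le_add_of_nonneg_right (by positivity)
  · have h4 := hratio' n l (by omega)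
    have h5 := exp_neg_inv_le (x := ν n / ν l * (q * ν 0)) (by positivity) (M + 2)
    have h6 : (ν n / ν l * (q * ν 0))⁻¹ = ν l / ν n / (q * ν 0) := by
      rw [mul_inv, inv_div, div_eq_mul_inv (ν l / ν n)]
    rw [h6] at h5
    rw [← le_div_iff₀ hl]
    calc (ν 0 / (ν 0 - 1)) ^ N * Real.exp (-(ν l / ν n / (q * ν 0)))
        ≤ (ν 0 / (ν 0 - 1)) ^ N * ((M + 2).factorial * (ν n / ν l * (q * ν 0)) ^ (M + 2)) :=
          mul_le_mul_of_nonneg_left h5 (by positivity)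
      _ = (ν 0 / (ν 0 - 1)) ^ N * ((M + 2).factorial * (q * ν 0) ^ (M + 2)) *
            (ν n / ν l) ^ (M + 1) * (ν n / ν l) := by rw [mul_pow]; ring
      _ ≤ (ν 0 / (ν 0 - 1)) ^ N * ((M + 2).factorial * (q * ν 0) ^ (M + 2)) *
            (q ^ (M + 1) * ((c⁻¹) ^ (M + 1)) ^ (l - n)) * (ν n / ν l) :=
          mul_le_mul_of_nonneg_right (mul_le_mul_of_nonneg_left h4 (by positivity))
            (by positivity)
      _ ≤ leakageConst (ν 0) q N M * ((c⁻¹) ^ (M + 1)) ^ (l - n) * (ν n / ν l) := by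
          unfold leakageConst
          refine mul_le_mul_of_nonneg_right ?_ (by positivity)
          rw [← mul_assoc, mul_comm _ (q ^ (M + 1))]
          refine mul_le_mul_of_nonneg_right ?_ (by positivity)
          refine mul_le_mul_of_nonneg_left ?_ (by positivity)
          exact le_add_of_nonneg_left (by positivity)
      _ = _ := by ring
  · simp

/-! ### Summation over the indices and absorption. -/

lemma sum_pow_le_of_injOn {r : ℝ} (h0 : 0 ≤ r) (h1 : r < 1) (T : Finset ℕ) (φ : ℕ → ℕ)
    (hφ : Set.InjOn φ T) : ∑ n ∈ T, r ^ φ n ≤ (1 - r)⁻¹ := by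
  rw [← Finset.sum_image hφ (f := fun k => r ^ k), ← tsum_geometric_of_lt_one h0 h1]
  exact (summable_geometric_of_lt_one h0 h1).sum_le_tsum _ fun _ _ => by positivity

lemma sum_far_pow_le {r Z : ℝ} (h0 : 0 ≤ r) (h1 : r < 1) (hZ : 0 ≤ Z) (H n₀ l : ℕ) :
    ∑ n ∈ (Finset.range n₀).filter (fun n => l + H < n), Z * r ^ (n - l) ≤
        Z * r ^ H / (1 - r) ∧
      ∑ n ∈ (Finset.range n₀).filter (fun n => n + H < l), Z * r ^ (l - n) ≤
        Z * r ^ H / (1 - r) := by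
  constructor
  · have h := sum_pow_le_of_injOn h0 h1 ((Finset.range n₀).filter (fun n => l + H < n))
      (fun n => n - l - H) (fun x hx y hy hxy => by
        simp only [Finset.coe_filter, Set.mem_ofPred_eq] at hx hy hxy; omega)
    calc _ = Z * r ^ H * ∑ n ∈ (Finset.range n₀).filter (fun n => l + H < n), r ^ (n - l - H) := by
          rw [Finset.mul_sum]
          refine Finset.sum_congr rfl fun n hn => ?_
          rw [mul_assoc, ← pow_add]
          congr 2
          have := (Finset.mem_filter.1 hn).2
          omega
      _ ≤ _ := by
          rw [div_eq_mul_inv]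
          exact mul_le_mul_of_nonneg_left h (by positivity)
  · have h := sum_pow_le_of_injOn h0 h1 ((Finset.range n₀).filter (fun n => n + H < l))
      (fun n => l - n - H) (fun x hx y hy hxy => by
        simp only [Finset.coe_filter, Set.mem_ofPred_eq] at hx hy hxy; omega)
    calc _ = Z * r ^ H * ∑ n ∈ (Finset.range n₀).filter (fun n => n + H < l), r ^ (l - n - H) := by
          rw [Finset.mul_sum]
          refine Finset.sum_congr rfl fun n hn => ?_
          rw [mul_assoc, ← pow_add]
          congr 2
          have := (Finset.mem_filter.1 hn).2
          omega
      _ ≤ _ := by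
          rw [div_eq_mul_inv]
          exact mul_le_mul_of_nonneg_left h (by positivity)

/-- Absorption: an inequality `u ≤ J + m u` whose matrix has column sums at most `1 / 2`. -/
lemma sum_le_two_mul_of_column_sum_le {ι : Type*} (T : Finset ι) {u J : ι → ℝ} {m : ι → ι → ℝ}
    (hu : ∀ i ∈ T, 0 ≤ u i) (hm : ∀ l ∈ T, ∑ n ∈ T, m n l ≤ 1 / 2)
    (h : ∀ n ∈ T, u n ≤ J n + ∑ l ∈ T, m n l * u l) : ∑ n ∈ T, u n ≤ 2 * ∑ n ∈ T, J n := by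
  have h1 := Finset.sum_le_sum h
  rw [Finset.sum_add_distrib, Finset.sum_comm] at h1
  have h2 : ∑ l ∈ T, ∑ n ∈ T, m n l * u l ≤ ∑ l ∈ T, 1 / 2 * u l := by
    refine Finset.sum_le_sum fun l hl => ?_
    rw [← Finset.sum_mul]
    exact mul_le_mul_of_nonneg_right (hm l hl) (hu l hl)
  rw [← Finset.mul_sum] at h2
  linarith

/-- If a point lies in the intervals of `p` and `p + d`, then `ν (p + d) < R ν p`, and growth forces
`d < k`. So no point is covered more than `k` times. -/
lemma sum_integral_dyadic_le {ν : ℕ → ℝ} (hpos : ∀ i, 0 < ν i) {c q : ℝ} (hc : 1 < c)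
    (hq : 0 < q) (hgrow : ∀ l m, c ^ m * ν l ≤ q * ν (l + m)) {R : ℝ} (hR : 1 ≤ R) {k : ℕ}
    (hk : q * R ≤ c ^ k) {g : ℝ → ℝ} (hg : ∀ t, 0 ≤ g t) (hgi : IntegrableOn g (Set.Ioi 0))
    (n₀ : ℕ) :
    ∑ n ∈ Finset.range n₀, ∫ t in (ν n)⁻¹..(R * (ν n)⁻¹), g t ≤ k * ∫ t in Set.Ioi 0, g t := by
  have hI : ∀ n, ∫ t in (ν n)⁻¹..(R * (ν n)⁻¹), g t =
      ∫ t in Set.Ioi 0, (Set.Ioc (ν n)⁻¹ (R * (ν n)⁻¹)).indicator g t := fun n => by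
    have hn := inv_pos.2 (hpos n)
    rw [intervalIntegral.integral_of_le (le_mul_of_one_le_left hn.le hR),
      setIntegral_indicator measurableSet_Ioc, Set.inter_eq_right.2]
    exact fun t ht => hn.trans ht.1
  simp only [hI]
  rw [← integral_finsetSum, ← integral_const_mul]
  swap
  · exact fun n _ => hgi.indicator measurableSet_Ioc
  refine integral_mono (integrable_finsetSum _ fun n _ => hgi.indicator measurableSet_Ioc)
    (hgi.const_mul _) fun t => ?_
  simp only [Set.indicator_apply]
  rw [← Finset.sum_filter, Finset.sum_const, nsmul_eq_mul]
  refine mul_le_mul_of_nonneg_right ?_ (hg t)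
  norm_cast
  set T := (Finset.range n₀).filter fun n => t ∈ Set.Ioc (ν n)⁻¹ (R * (ν n)⁻¹) with hT
  rcases T.eq_empty_or_nonempty with h | h
  · rw [h, Finset.card_empty]; exact Nat.zero_le _
  · have hsub : T ⊆ Finset.Ico (T.min' h) (T.min' h + k) := by
      intro m hm
      have hle := Finset.min'_le T m hm
      have h1 := (Finset.mem_filter.1 (Finset.min'_mem T h)).2
      have h2 := (Finset.mem_filter.1 hm).2
      refine Finset.mem_Ico.2 ⟨hle, ?_⟩
      set p := T.min' h
      obtain ⟨d, rfl⟩ := Nat.exists_eq_add_of_le hle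
      have h3 := hgrow p d
      have h4 : (ν p)⁻¹ < R * (ν (p + d))⁻¹ := h1.1.trans_le h2.2
      have hp := hpos p
      have hpd := hpos (p + d)
      have h5 : ν (p + d) < R * ν p := by
        rw [← div_eq_mul_inv, lt_div_iff₀ hpd, inv_mul_lt_iff₀ hp, mul_comm] at h4
        exact h4
      have h6 : c ^ d * ν p < c ^ k * ν p := by nlinarith
      have := (pow_lt_pow_iff_right₀ hc).1 (lt_of_mul_lt_mul_right h6 hp.le)
      omega
    simpa using Finset.card_le_card hsub

lemma abs_coeff_div_le {ν : ℕ → ℝ} (hν : StrictMono ν) (h0 : 1 < ν 0) {c q : ℝ}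
    {N : ℕ} {s : ℕ → ℕ} (hq : 1 ≤ q) (hs : IsBlockStart ν c q N s) {H M : ℕ} {γ : ℝ} (hγ : 0 < γ)
    {n : ℕ} (hγn : ∀ t, γ ^ (2 * H + N + M) * Real.exp (-ν n * t) ≤
        |Polynomial.aeval (translation (ν n)⁻¹)
          (annihilator ν (ν n)⁻¹ (annihilationWindow s N H n) M) (blockExp ν s n) t|)
    {n₀ : ℕ} (hn : n < n₀) (b : ℕ → ℝ) {f : ℝ → ℝ} (hfc : Continuous f)
    (hf : ∀ t, f t = ∑ l ∈ Finset.range n₀, b l * blockExp ν s l t) :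
    |b n| / ν n ≤ Real.exp 2 * (2 / γ) ^ (2 * H + N + M) *
      (2 ^ (2 * H + N + M) *
        (∫ t in (ν n)⁻¹..((2 + (2 * H + N + M : ℕ)) * (ν n)⁻¹), |f t|) +
        ∑ l ∈ Finset.range n₀, leakage ν s q N H M n l / ν n * |b l|) := by
  have hpos : ∀ j, 0 < ν j := fun j => by linarith [hν.monotone (Nat.zero_le j)]
  set D := 2 * H + N + M with hD
  set a := (ν n)⁻¹ with ha'
  have ha : 0 < a := inv_pos.2 (hpos n)
  set W := annihilationWindow s N H n with hW
  have hWc : W.card ≤ 2 * H + N := card_annihilationWindow_le s N H n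
  have hT := translationBound_annihilator (fun i => (hpos i).le) ha.le W M
  set T := Polynomial.aeval (translation a) (annihilator ν a W M) with hTdef
  set S := ∑ l ∈ Finset.range n₀, leakage ν s q N H M n l * |b l| with hS
  set K := Real.exp 2 * (2 / γ) ^ D with hK
  have hK0 : 0 ≤ K := by positivity
  have hcont : Continuous (T f) := hT.continuous f hfc
  -- The interval has length `a = 1 / ν_n`, so integrating the pointwise bound produces the quotient
  -- by `ν_n`.
  have h1 : ∫ _ in a..(2 * a), |b n| ≤ ∫ t in a..(2 * a), K * (|T f t| + S) := by
    refine intervalIntegral.integral_mono_on (by linarith) intervalIntegrable_const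
      (Continuous.intervalIntegrable (by fun_prop) _ _) fun t ht => ?_
    exact abs_coeff_le_of_expansion hν h0 hq hs hγ hγn hn b hf ht.1 ht.2
  rw [intervalIntegral.integral_const, intervalIntegral.integral_const_mul,
    intervalIntegral.integral_add (hcont.abs.intervalIntegrable _ _) intervalIntegrable_const,
    intervalIntegral.integral_const, smul_eq_mul, smul_eq_mul] at h1
  have h2 := hT.integral_le f hfc a (2 * a) (by linarith)
  have h3 : ∫ t in a..(2 * a + (W.card + M : ℕ) * a), |f t| ≤
      ∫ t in a..((2 + D) * a), |f t| := by
    have hle : ((W.card + M : ℕ) : ℝ) ≤ D := by exact_mod_cast (by omega : W.card + M ≤ D)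
    have hc0 : (0 : ℝ) ≤ (W.card + M : ℕ) := Nat.cast_nonneg _
    refine intervalIntegral.integral_mono_interval le_rfl (by nlinarith) (by nlinarith)
      (Filter.Eventually.of_forall fun t => abs_nonneg _) (hfc.abs.intervalIntegrable _ _)
  have h4 : (2 : ℝ) ^ (W.card + M) ≤ 2 ^ D := pow_le_pow_right₀ one_le_two (by omega)
  have h5 : 0 ≤ ∫ t in a..((2 + D) * a), |f t| := by
    refine intervalIntegral.integral_nonneg ?_ fun t _ => abs_nonneg _
    have : (0 : ℝ) ≤ D := Nat.cast_nonneg _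
    nlinarith
  have h6 : ∫ t in a..(2 * a), |T f t| ≤ 2 ^ D * ∫ t in a..((2 + D) * a), |f t| :=
    h2.trans (mul_le_mul h4 h3
      (intervalIntegral.integral_nonneg (by nlinarith [Nat.cast_nonneg (α := ℝ) (W.card + M)])
        fun t _ => abs_nonneg _) (by positivity))
  have h7 : ∑ l ∈ Finset.range n₀, leakage ν s q N H M n l / ν n * |b l| = a * S := by
    rw [hS, Finset.mul_sum]
    exact Finset.sum_congr rfl fun l _ => by rw [ha']; ring
  rw [h7, div_eq_mul_inv, mul_comm]
  have h8 : (2 * a - a) * |b n| = a * |b n| := by ring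
  rw [h8] at h1
  refine h1.trans (mul_le_mul_of_nonneg_left ?_ hK0)
  linarith

theorem exists_sum_coeff_div_le {ν : ℕ → ℝ} (hν : StrictMono ν) (h0 : 1 < ν 0) {c q : ℝ}
    {N : ℕ} {s : ℕ → ℕ} (hN : 0 < N) (hq : 1 ≤ q) (hc : 1 < c) (hs : IsBlockStart ν c q N s)
    (hgrow : ∀ l m, c ^ m * ν l ≤ q * ν (l + m)) :
    ∃ C : ℝ, 0 ≤ C ∧ ∀ (n₀ : ℕ) (b : ℕ → ℝ) (f : ℝ → ℝ), Continuous f →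
      IntegrableOn f (Set.Ioi 0) →
      (∀ t, f t = ∑ l ∈ Finset.range n₀, b l * blockExp ν s l t) →
      ∑ n ∈ Finset.range n₀, |b n| / ν n ≤ C * ∫ t in Set.Ioi 0, |f t| := by
  have hpos : ∀ j, 0 < ν j := fun j => by linarith [hν.monotone (Nat.zero_le j)]
  obtain ⟨γ, hγ0, hγ1, hγ⟩ := exists_le_abs_aeval_annihilator_blockExp_self hc hq
  have hA : 0 < 2 / γ := by positivity
  have hA1 : 1 ≤ 2 / γ := by rw [le_div_iff₀ hγ0]; linarith
  -- The arguments anticipate `w ^ N * K = (4 N q) ^ N * K ^ (N + 1)`, with `w` and `K` as below.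
  obtain ⟨M, H, hMH⟩ := exists_difference_order_and_window (E := Real.exp 2)
    (P := (4 * N * q) ^ N) hA hc N (leakageConst (ν 0) q N)
  set r := (c⁻¹) ^ (M + 1) with hr
  have hr0 : 0 ≤ r := by have : 0 < c := by linarith
                         positivity
  have hr1 : r < 1 := pow_lt_one₀ (inv_nonneg.2 (by linarith)) (inv_lt_one_of_one_lt₀ hc) (by omega)
  set D := 2 * H + N + M with hD
  set K := Real.exp 2 * (2 / γ) ^ D with hK
  have hK1 : 1 ≤ K := one_le_mul_of_one_le_of_one_le (Real.one_le_exp (by norm_num))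
    (one_le_pow₀ hA1)
  have hK0 : 0 < K := by linarith
  have hN1 : (1 : ℝ) ≤ N := by exact_mod_cast hN
  -- One step forward in a block gains a factor `w`, which turns the leakage `K q` into `1 / (4 N)`.
  -- With at most `N` such entries per column, the block contributes `1 / 4`; each far side
  -- contributes `1 / 8`.
  set w := 4 * N * q * K with hw
  have hw1 : 1 ≤ w := by
    have : 1 ≤ 4 * (N : ℝ) * q := by nlinarith
    exact one_le_mul_of_one_le_of_one_le this hK1
  have hw0 : 0 < w := by linarith
  set Z := w ^ N * K * leakageConst (ν 0) q N M with hZ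
  have hL := leakageConst_nonneg h0 hq N M
  have hZ0 : 0 ≤ Z := by positivity
  have hZ8 : Z * r ^ H / (1 - r) ≤ 1 / 8 := by
    refine le_trans (le_of_eq ?_) hMH
    rw [hZ, hw, mul_pow _ K, pow_succ K]
    ring
  obtain ⟨k, hk⟩ := pow_unbounded_of_one_lt (q * (2 + D)) hc
  refine ⟨2 * (w ^ N * K * 2 ^ D * k), by positivity, fun n₀ b f hfc hfi hf => ?_⟩
  set m : ℕ → ℕ → ℝ := fun n l => if n < l ∧ s l ≤ n then 1 / (4 * N)
    else if l + H < n then Z * r ^ (n - l) else if n + H < l then Z * r ^ (l - n) else 0 with hm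
  set u : ℕ → ℝ := fun n => w ^ (n - s n) * (|b n| / ν n) with hu
  have hpow : ∀ n, w ^ (n - s n) ≤ w ^ N := fun n => by
    have := hs.lt_add n
    exact pow_le_pow_right₀ hw1 (by omega)
  have hu_ge : ∀ n, |b n| / ν n ≤ u n := fun n =>
    le_mul_of_one_le_left (div_nonneg (abs_nonneg _) (hpos n).le) (one_le_pow₀ hw1)
  have hcol : ∀ l ∈ Finset.range n₀, ∑ n ∈ Finset.range n₀, m n l ≤ 1 / 2 := by
    intro l _
    have hsplit : ∀ n, m n l ≤ (if n ∈ Finset.Ico (s l) l then 1 / (4 * (N : ℝ)) else 0) +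
        (if l + H < n then Z * r ^ (n - l) else 0) +
        (if n + H < l then Z * r ^ (l - n) else 0) := by
      intro n
      have e1 : 0 ≤ Z * r ^ (n - l) := by positivity
      have e2 : 0 ≤ Z * r ^ (l - n) := by positivity
      have e3 : (0 : ℝ) ≤ 1 / (4 * N) := by positivity
      simp only [hm, Finset.mem_Ico]
      split_ifs <;> first | omega | linarith
    refine (Finset.sum_le_sum fun n _ => hsplit n).trans ?_
    rw [Finset.sum_add_distrib, Finset.sum_add_distrib, ← Finset.sum_filter, ← Finset.sum_filter,
      ← Finset.sum_filter]
    have hfar := sum_far_pow_le hr0 hr1 hZ0 H n₀ l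
    have hblk : ∑ n ∈ (Finset.range n₀).filter (fun n => n ∈ Finset.Ico (s l) l),
        1 / (4 * (N : ℝ)) ≤ 1 / 4 := by
      rw [Finset.sum_const, nsmul_eq_mul]
      have hcard : ((Finset.range n₀).filter (fun n => n ∈ Finset.Ico (s l) l)).card ≤ N := by
        refine (Finset.card_le_card (fun n hn => (Finset.mem_filter.1 hn).2)).trans ?_
        rw [Nat.card_Ico]
        have := hs.lt_add l
        omega
      have : (((Finset.range n₀).filter (fun n => n ∈ Finset.Ico (s l) l)).card : ℝ) ≤ N := by
        exact_mod_cast hcard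
      rw [mul_one_div, div_le_iff₀ (by positivity)]
      linarith
    linarith [hfar.1, hfar.2]
  have hweight : ∀ n l, w ^ (n - s n) * K * (leakage ν s q N H M n l / ν n * |b l|) ≤
      m n l * u l := by
    intro n l
    have e1 := leakage_div_le hν h0 hq hc hs hgrow H M n l
    set X := if n < l ∧ s l ≤ n then q
        else if l + H < n then leakageConst (ν 0) q N M * ((c⁻¹) ^ (M + 1)) ^ (n - l)
        else if n + H < l then leakageConst (ν 0) q N M * ((c⁻¹) ^ (M + 1)) ^ (l - n)
        else 0 with hX
    have e2 : w ^ (n - s n) * K * X ≤ m n l * w ^ (l - s l) := by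
      have hone : 1 ≤ w ^ (l - s l) := one_le_pow₀ hw1
      have hfar : ∀ i : ℕ, w ^ (n - s n) * K * (leakageConst (ν 0) q N M * r ^ i) ≤
          Z * r ^ i * w ^ (l - s l) := fun i => by
        have e3 : w ^ (n - s n) * K * (leakageConst (ν 0) q N M * r ^ i) ≤ Z * r ^ i := by
          rw [hZ, ← mul_assoc]
          refine mul_le_mul_of_nonneg_right ?_ (by positivity)
          refine mul_le_mul_of_nonneg_right ?_ hL
          exact mul_le_mul_of_nonneg_right (hpow n) hK0.le
        exact e3.trans (le_mul_of_one_le_right (by positivity) hone)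
      simp only [hm, hX]
      split_ifs with h1 h2 h3
      · have hsn := hs.eq_of_mem l n h1.2 h1.1.le
        have e4 : w ^ (n - s n) * w ≤ w ^ (l - s l) := by
          rw [← pow_succ]
          exact pow_le_pow_right₀ hw1 (by omega)
        calc w ^ (n - s n) * K * q = 1 / (4 * N) * (w ^ (n - s n) * w) := by
              rw [hw]; field_simp
          _ ≤ _ := mul_le_mul_of_nonneg_left e4 (by positivity)
      · exact hfar _
      · exact hfar _
      · simp
    calc w ^ (n - s n) * K * (leakage ν s q N H M n l / ν n * |b l|)
        ≤ w ^ (n - s n) * K * (X / ν l * |b l|) := by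
          refine mul_le_mul_of_nonneg_left ?_ (by positivity)
          exact mul_le_mul_of_nonneg_right e1 (abs_nonneg _)
      _ = w ^ (n - s n) * K * X * (|b l| / ν l) := by ring
      _ ≤ m n l * w ^ (l - s l) * (|b l| / ν l) :=
          mul_le_mul_of_nonneg_right e2 (div_nonneg (abs_nonneg _) (hpos l).le)
      _ = m n l * u l := by rw [hu]; ring
  have hint : ∀ n, 0 ≤ ∫ t in (ν n)⁻¹..((2 + D) * (ν n)⁻¹), |f t| := fun n => by
    refine intervalIntegral.integral_nonneg ?_ fun t _ => abs_nonneg _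
    have h1 : (0 : ℝ) ≤ D := Nat.cast_nonneg _
    have h2 := inv_pos.2 (hpos n)
    nlinarith
  have hstep : ∀ n ∈ Finset.range n₀, u n ≤
      w ^ N * K * 2 ^ D * (∫ t in (ν n)⁻¹..((2 + D) * (ν n)⁻¹), |f t|) +
        ∑ l ∈ Finset.range n₀, m n l * u l := by
    intro n hn
    have e1 := abs_coeff_div_le hν h0 hq hs hγ0 (hγ hν hpos hs H M n) (Finset.mem_range.1 hn) b
      hfc hf
    have e2 := mul_le_mul_of_nonneg_left e1 (show 0 ≤ w ^ (n - s n) by positivity)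
    refine e2.trans ?_
    rw [← hD, ← hK, ← mul_assoc, mul_add, Finset.mul_sum]
    refine add_le_add ?_ (Finset.sum_le_sum fun l _ => hweight n l)
    rw [← mul_assoc]
    refine mul_le_mul_of_nonneg_right ?_ (hint n)
    refine mul_le_mul_of_nonneg_right ?_ (by positivity)
    exact mul_le_mul_of_nonneg_right (hpow n) hK0.le
  have habs := sum_le_two_mul_of_column_sum_le (Finset.range n₀)
    (fun n _ => mul_nonneg (by positivity) (div_nonneg (abs_nonneg _) (hpos n).le)) hcol hstep
  rw [← Finset.mul_sum] at habs
  have hov := sum_integral_dyadic_le hpos hc (by linarith) hgrow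
    (R := 2 + D) (by have : (0 : ℝ) ≤ D := Nat.cast_nonneg _
                     linarith) hk.le (g := fun t => |f t|)
    (fun t => abs_nonneg _) hfi.abs n₀
  calc ∑ n ∈ Finset.range n₀, |b n| / ν n ≤ ∑ n ∈ Finset.range n₀, u n :=
        Finset.sum_le_sum fun n _ => hu_ge n
    _ ≤ _ := habs
    _ ≤ 2 * (w ^ N * K * 2 ^ D * (k * ∫ t in Set.Ioi 0, |f t|)) := by gcongr
    _ = _ := by ring

theorem exists_exponential_majorant {ν : ℕ → ℝ} (hν : StrictMono ν) (h0 : 1 < ν 0) {q : ℝ}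
    {N : ℕ} (hN : 0 < N) (hq : 1 < q) (hgrow : ∀ i, q * ν i ≤ ν (i + N)) :
    ∃ C : ℝ, 0 ≤ C ∧ ∃ κ : ℕ → ℝ, (∀ i, 1 ≤ κ i) ∧ ∀ (n₀ : ℕ) (a : ℕ → ℝ), ∃ A : ℕ → ℝ,
      (∀ i, 0 ≤ A i) ∧
      (∀ t, 0 ≤ t → |∑ i ∈ Finset.range n₀, a i * Real.exp (-ν i * t)| ≤
        ∑ i ∈ Finset.range n₀, A i * Real.exp (-κ i * t)) ∧
      ∑ i ∈ Finset.range n₀, A i / κ i ≤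
        C * ∫ t in Set.Ioi 0, |∑ i ∈ Finset.range n₀, a i * Real.exp (-ν i * t)| := by
  have hpos : ∀ j, 0 < ν j := fun j => by linarith [hν.monotone (Nat.zero_le j)]
  obtain ⟨c, hc, hcq⟩ : ∃ c : ℝ, 1 < c ∧ c ^ N = q :=
    ⟨q ^ ((N : ℝ)⁻¹), Real.one_lt_rpow hq (by positivity),
      Real.rpow_inv_natCast_pow (by linarith) hN.ne'⟩
  set s := blockStart ν c
  have hs : IsBlockStart ν c q N s := isBlockStart_blockStart hν hpos hN hc hcq hgrow
  obtain ⟨C, hC0, hC⟩ := exists_sum_coeff_div_le hν h0 hN hq.le hc hs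
    (pow_mul_le_of_growth hν hpos hN hc hcq hgrow)
  set B := (ν 0 / (ν 0 - 1)) ^ N
  have hB : 0 ≤ B := pow_nonneg (div_nonneg (hpos 0).le (by linarith)) _
  have h00 := hpos 0
  -- The factor `ν 0 * q` compares `1 / κ i = ν 0 / ν (s i)` with `1 / ν i`.
  refine ⟨B * ν 0 * q * C, by positivity, fun i => ν (s i) / ν 0, fun i => ?_, fun n₀ a => ?_⟩
  · rw [le_div_iff₀ h00, one_mul]
    exact hν.monotone (Nat.zero_le _)
  obtain ⟨b, hb⟩ := exists_blockExp_expansion hν.injective hpos hs.le n₀ a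
  refine ⟨fun i => B * |b i|, fun i => by positivity, fun t ht => ?_, ?_⟩
  · beta_reduce
    rw [hb]
    refine (Finset.abs_sum_le_sum_abs _ _).trans (Finset.sum_le_sum fun l _ => ?_)
    rw [abs_mul, mul_comm B, mul_assoc]
    exact mul_le_mul_of_nonneg_left (abs_blockExp_le hν h0 hs l ht) (abs_nonneg _)
  · have h1 := hC n₀ b (fun t => ∑ i ∈ Finset.range n₀, a i * Real.exp (-ν i * t))
      (by fun_prop) (integrable_finsetSum _ fun i _ =>
        (integrableOn_exp_mul_Ioi (neg_lt_zero.2 (hpos i)) 0).const_mul _) hb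
    rw [mul_assoc _ C]
    refine le_trans ?_ (mul_le_mul_of_nonneg_left h1 (by positivity))
    rw [Finset.mul_sum]
    refine Finset.sum_le_sum fun l _ => ?_
    have hsl := hpos (s l)
    have hl := hpos l
    have h2 := hs.le_mul l
    rw [div_div_eq_mul_div, mul_div_assoc', div_le_div_iff₀ hsl hl]
    calc B * |b l| * ν 0 * ν l ≤ B * |b l| * ν 0 * (q * ν (s l)) :=
          mul_le_mul_of_nonneg_left h2 (by positivity)
      _ = _ := by ring

/-! ### From exponential sums to Müntz polynomials. -/

/-- In a quasilacunary sequence the exponents shifted by `1` grow by a fixed factor over a fixed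
number of steps. -/
lemma exists_growth_of_isQuasilacunary {Λ : ℕ → ℝ} (hΛ : IsMuntzSequence Λ)
    (hq : IsQuasilacunary Λ) :
    ∃ (N : ℕ) (q : ℝ), 0 < N ∧ 1 < q ∧ ∀ i, q * (Λ i + 1) ≤ Λ (i + N) + 1 := by
  obtain ⟨n, hn, ⟨q, hq1, hratio⟩, N, hN⟩ := hq
  have hmono := hΛ.strictMono.monotone
  have hpos := hΛ.pos
  -- If `n k ≤ i < n (k + 1)`, then `n (k + 2) ≤ i + 2 * N`, and the interval from `n (k + 1)` to `n
  -- (k + 2)` contains a full ratio `q`.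
  have hstep : ∀ i, n 0 ≤ i → q * Λ i ≤ Λ (i + 2 * N) := by
    intro i hi
    have hex : ∃ k, i < n (k + 1) := ⟨i, by have := hn.id_le (i + 1); simp at this; omega⟩
    set k := Nat.find hex
    have h1 : i < n (k + 1) := Nat.find_spec hex
    have h2 : n k ≤ i := by
      rcases Nat.eq_zero_or_pos k with h | h
      · rw [h]; exact hi
      · obtain ⟨j, hj⟩ := Nat.exists_eq_succ_of_ne_zero h.ne'
        have := Nat.find_min hex (m := j) (by omega)
        rw [hj]
        exact not_lt.1 this
    have h3 : n (k + 2) ≤ i + 2 * N := by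
      have e1 := hN k
      have e2 : n (k + 2) ≤ n (k + 1) + N := hN (k + 1)
      omega
    calc q * Λ i ≤ q * Λ (n (k + 1)) := mul_le_mul_of_nonneg_left (hmono h1.le) (by linarith)
      _ ≤ Λ (n (k + 2)) := by
          have := hratio (k + 1)
          rwa [le_div_iff₀ (hpos _)] at this
      _ ≤ _ := hmono h3
  have h0 := hpos 0
  -- The term `n 0` covers the indices before the first `n k`. The new ratio is the value at `Λ 0`
  -- of the increasing function `(q x + 1) / (x + 1)`.
  refine ⟨2 * N + n 0 + 1, (q * Λ 0 + 1) / (Λ 0 + 1), by omega, ?_, fun i => ?_⟩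
  · rw [lt_div_iff₀ (by linarith)]
    nlinarith
  · have h1 : q * Λ i ≤ Λ (i + (2 * N + n 0 + 1)) := by
      calc q * Λ i ≤ q * Λ (i + n 0) :=
            mul_le_mul_of_nonneg_left (hmono (by omega)) (by linarith)
        _ ≤ Λ (i + n 0 + 2 * N) := hstep _ (by omega)
        _ ≤ _ := hmono (by omega)
    have h2 : Λ 0 ≤ Λ i := hmono (Nat.zero_le i)
    have h3 : (q * Λ 0 + 1) / (Λ 0 + 1) * (Λ i + 1) ≤ q * Λ i + 1 := by
      rw [div_mul_eq_mul_div, div_le_iff₀ (by linarith)]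
      nlinarith
    linarith

lemma exists_eq_sum_of_mem_muntzPolynomials {𝕜 : Type*} [RCLike 𝕜] {Λ : ℕ → ℝ} {p : ℝ → 𝕜}
    (hp : p ∈ muntzPolynomials 𝕜 Λ) :
    ∃ (n₀ : ℕ) (a : ℕ → 𝕜), ∀ x, p x = ∑ i ∈ Finset.range n₀, a i * ((x ^ Λ i : ℝ) : 𝕜) := by
  obtain ⟨c, rfl⟩ := (Finsupp.mem_span_range_iff_exists_finsupp).1 hp
  obtain ⟨n₀, hn₀⟩ := c.support.exists_nat_subset_range
  refine ⟨n₀, c, fun x => ?_⟩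
  rw [Finsupp.sum_of_support_subset c hn₀ (fun i a => a • monomialFun 𝕜 (Λ i))
    (fun i _ => zero_smul _ _), Finset.sum_apply]
  exact Finset.sum_congr rfl fun i _ => rfl

lemma lintegral_Ioo_eq_lintegral_exp_neg (F : ℝ → ENNReal) :
    ∫⁻ x in Set.Ioo (0 : ℝ) 1, F x =
      ∫⁻ t in Set.Ioi (0 : ℝ), ENNReal.ofReal (Real.exp (-t)) * F (Real.exp (-t)) := by
  have himg : (fun t => Real.exp (-t)) '' Set.Ioi 0 = Set.Ioo 0 1 := by
    ext x
    constructor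
    · rintro ⟨t, ht, rfl⟩
      exact ⟨Real.exp_pos _, Real.exp_lt_one_iff.2 (neg_lt_zero.2 ht)⟩
    · intro hx
      exact ⟨-Real.log x, neg_pos.2 (Real.log_neg hx.1 hx.2), by simp [Real.exp_log hx.1]⟩
  rw [← himg, lintegral_image_eq_lintegral_abs_deriv_mul measurableSet_Ioi
    (f' := fun t => -Real.exp (-t))]
  · simp only [abs_neg, Real.abs_exp]
  · intro t _
    simpa using ((hasDerivAt_id t).neg.exp).hasDerivWithinAt
  · intro t _ u _ h
    simpa using h

lemma eLpNorm_one_lebesgueUnit {𝕜 : Type*} [RCLike 𝕜] (p : ℝ → 𝕜) :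
    eLpNorm p 1 lebesgueUnit = ∫⁻ x in Set.Ioo (0 : ℝ) 1, ‖p x‖ₑ := by
  rw [eLpNorm_one_eq_lintegral_enorm, lebesgueUnit, restrict_Ioo_eq_restrict_Icc]

/-- The integral of a real exponential sum dominated by a function on the unit interval. -/
lemma ofReal_integral_exp_sum_le {Λ : ℕ → ℝ} (hΛ : ∀ i, 0 < Λ i) (n₀ : ℕ) (a : ℕ → ℝ)
    {F : ℝ → ENNReal} (hF : ∀ x ∈ Set.Ioo (0 : ℝ) 1,
      ENNReal.ofReal |∑ i ∈ Finset.range n₀, a i * x ^ Λ i| ≤ F x) :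
    ENNReal.ofReal (∫ t in Set.Ioi 0, |∑ i ∈ Finset.range n₀, a i * Real.exp (-(Λ i + 1) * t)|) ≤
      ∫⁻ x in Set.Ioo (0 : ℝ) 1, F x := by
  have hint : IntegrableOn (fun t => ∑ i ∈ Finset.range n₀, a i * Real.exp (-(Λ i + 1) * t))
      (Set.Ioi 0) := integrable_finsetSum _ fun i _ =>
    (integrableOn_exp_mul_Ioi (by linarith [hΛ i]) 0).const_mul _
  rw [ofReal_integral_eq_lintegral_ofReal hint.abs (Filter.Eventually.of_forall fun t => abs_nonneg _),
    lintegral_Ioo_eq_lintegral_exp_neg]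
  refine setLIntegral_mono' measurableSet_Ioi fun t ht => ?_
  have hx : Real.exp (-t) ∈ Set.Ioo (0 : ℝ) 1 :=
    ⟨Real.exp_pos _, Real.exp_lt_one_iff.2 (neg_lt_zero.2 ht)⟩
  refine le_trans (le_of_eq ?_) (mul_le_mul_right (hF _ hx) _)
  rw [← ENNReal.ofReal_mul (Real.exp_pos _).le]
  congr 1
  rw [← abs_of_pos (Real.exp_pos (-t)), ← abs_mul, abs_of_pos (Real.exp_pos (-t)), Finset.mul_sum]
  congr 1
  refine Finset.sum_congr rfl fun i _ => ?_
  rw [← Real.exp_mul, mul_left_comm, ← Real.exp_add]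
  ring_nf

lemma lintegral_rpow_sum_le {n₀ : ℕ} {A κ : ℕ → ℝ} (hA : ∀ i, 0 ≤ A i) (hκ : ∀ i, 1 ≤ κ i) :
    ∫⁻ x in Set.Ioo (0 : ℝ) 1, ENNReal.ofReal (∑ i ∈ Finset.range n₀, A i * x ^ (κ i - 1)) =
      ENNReal.ofReal (∑ i ∈ Finset.range n₀, A i / κ i) := by
  have hi : ∀ i, IntervalIntegrable (fun x : ℝ => x ^ (κ i - 1)) volume 0 1 := fun i =>
    intervalIntegral.intervalIntegrable_rpow' (by linarith [hκ i])
  have hint : IntegrableOn (fun x : ℝ => ∑ i ∈ Finset.range n₀, A i * x ^ (κ i - 1))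
      (Set.Ioo 0 1) := integrable_finsetSum _ fun i _ => by
    have := (intervalIntegrable_iff_integrableOn_Ioo_of_le zero_le_one).1 (hi i)
    exact this.const_mul _
  rw [← ofReal_integral_eq_lintegral_ofReal hint]
  · congr 1
    rw [← integral_Ioc_eq_integral_Ioo, ← intervalIntegral.integral_of_le zero_le_one,
      intervalIntegral.integral_finsetSum fun i _ => (hi i).const_mul _]
    refine Finset.sum_congr rfl fun i _ => ?_
    have := hκ i
    rw [intervalIntegral.integral_const_mul, integral_rpow (Or.inl (by linarith)), sub_add_cancel,
      Real.one_rpow, Real.zero_rpow (by linarith), sub_zero, mul_one_div]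
  · filter_upwards [ae_restrict_mem measurableSet_Ioo] with x hx
    exact Finset.sum_nonneg fun i _ => mul_nonneg (hA i) (Real.rpow_nonneg hx.1.le _)

lemma norm_le_abs_re_add_abs_im {𝕜 : Type*} [RCLike 𝕜] (z : 𝕜) :
    ‖z‖ ≤ |RCLike.re z| + |RCLike.im z| := by
  rw [← pow_le_pow_iff_left₀ (norm_nonneg z) (by positivity) two_ne_zero, RCLike.norm_sq_eq_def]
  nlinarith [mul_nonneg (abs_nonneg (RCLike.re z)) (abs_nonneg (RCLike.im z)),
    sq_abs (RCLike.re z), sq_abs (RCLike.im z)]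

/-- Every Müntz polynomial is dominated on `(0, 1)` by an increasing function whose integral is
controlled by the norm of the polynomial. -/
theorem exists_monotone_majorant (𝕜 : Type*) [RCLike 𝕜] {Λ : ℕ → ℝ} (hΛ : IsMuntzSequence Λ)
    (hq : IsQuasilacunary Λ) :
    ∃ C : ℝ, 0 < C ∧ ∀ p ∈ muntzPolynomials 𝕜 Λ, ∃ G : ℝ → ℝ, Measurable G ∧
      MonotoneOn G (Set.Ioo 0 1) ∧ (∀ x ∈ Set.Ioo (0 : ℝ) 1, ‖p x‖ ≤ G x) ∧
      ∫⁻ x in Set.Ioo (0 : ℝ) 1, ENNReal.ofReal (G x) ≤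
        ENNReal.ofReal C * eLpNorm p 1 lebesgueUnit := by
  obtain ⟨N, q, hN, hq1, hgrow⟩ := exists_growth_of_isQuasilacunary hΛ hq
  obtain ⟨C, hC0, κ, hκ, hC⟩ := exists_exponential_majorant (ν := fun i => Λ i + 1)
    (fun i j hij => by simpa using hΛ.strictMono hij) (by simpa using hΛ.pos 0) hN hq1 hgrow
  -- One `C` each for the real and imaginary parts; the `1` only ensures positivity.
  refine ⟨2 * C + 1, by linarith, fun p hp => ?_⟩
  obtain ⟨n₀, a, ha⟩ := exists_eq_sum_of_mem_muntzPolynomials hp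
  have hre : ∀ x, RCLike.re (p x) = ∑ i ∈ Finset.range n₀, RCLike.re (a i) * x ^ Λ i := fun x => by
    rw [ha, map_sum]
    exact Finset.sum_congr rfl fun i _ => RCLike.re_mul_ofReal _ _
  have him : ∀ x, RCLike.im (p x) = ∑ i ∈ Finset.range n₀, RCLike.im (a i) * x ^ Λ i := fun x => by
    rw [ha, map_sum]
    exact Finset.sum_congr rfl fun i _ => RCLike.im_mul_ofReal _ _
  obtain ⟨A, hA0, hA1, hA2⟩ := hC n₀ fun i => RCLike.re (a i)
  obtain ⟨A', hA'0, hA'1, hA'2⟩ := hC n₀ fun i => RCLike.im (a i)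
  have hexp : ∀ (b : ℕ → ℝ) (B : ℕ → ℝ), (∀ t, 0 ≤ t →
      |∑ i ∈ Finset.range n₀, b i * Real.exp (-(Λ i + 1) * t)| ≤
        ∑ i ∈ Finset.range n₀, B i * Real.exp (-κ i * t)) → ∀ x ∈ Set.Ioo (0 : ℝ) 1,
      |∑ i ∈ Finset.range n₀, b i * x ^ Λ i| ≤
        ∑ i ∈ Finset.range n₀, B i * x ^ (κ i - 1) := by
    intro b B h x hx
    have h1 := h (-Real.log x) (neg_nonneg.2 (Real.log_nonpos hx.1.le hx.2.le))
    have e1 : ∑ i ∈ Finset.range n₀, b i * Real.exp (-(Λ i + 1) * -Real.log x) =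
        x * ∑ i ∈ Finset.range n₀, b i * x ^ Λ i := by
      rw [Finset.mul_sum]
      refine Finset.sum_congr rfl fun i _ => ?_
      rw [neg_mul_neg, mul_comm (Λ i + 1), ← Real.rpow_def_of_pos hx.1, Real.rpow_add_one hx.1.ne']
      ring
    have e2 : ∑ i ∈ Finset.range n₀, B i * Real.exp (-κ i * -Real.log x) =
        x * ∑ i ∈ Finset.range n₀, B i * x ^ (κ i - 1) := by
      rw [Finset.mul_sum]
      refine Finset.sum_congr rfl fun i _ => ?_
      rw [neg_mul_neg, mul_comm (κ i), ← Real.rpow_def_of_pos hx.1, Real.rpow_sub_one hx.1.ne']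
      have := hx.1.ne'
      field_simp
    rw [e1, e2, abs_mul, abs_of_pos hx.1] at h1
    exact le_of_mul_le_mul_left h1 hx.1
  -- Monotonicity comes from `κ i ≥ 1`; the shift by 1 undoes the factor `x = exp (-t)` of the
  -- substitution.
  refine ⟨fun x => ∑ i ∈ Finset.range n₀, (A i + A' i) * x ^ (κ i - 1), by fun_prop, ?_, ?_, ?_⟩
  · intro x hx y hy hxy
    refine Finset.sum_le_sum fun i _ => mul_le_mul_of_nonneg_left ?_ (add_nonneg (hA0 i) (hA'0 i))
    exact Real.rpow_le_rpow hx.1.le hxy (by linarith [hκ i])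
  · intro x hx
    simp only [add_mul, Finset.sum_add_distrib]
    refine (norm_le_abs_re_add_abs_im (p x)).trans ?_
    rw [hre, him]
    exact add_le_add (hexp _ _ hA1 x hx) (hexp _ _ hA'1 x hx)
  · rw [lintegral_rpow_sum_le (fun i => add_nonneg (hA0 i) (hA'0 i)) hκ, eLpNorm_one_lebesgueUnit]
    have e1 := ofReal_integral_exp_sum_le hΛ.pos n₀ (fun i => RCLike.re (a i))
      (F := fun x => ‖p x‖ₑ) fun x _ => by
        rw [← hre, ← ofReal_norm]
        exact ENNReal.ofReal_le_ofReal (RCLike.abs_re_le_norm _)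
    have e2 := ofReal_integral_exp_sum_le hΛ.pos n₀ (fun i => RCLike.im (a i))
      (F := fun x => ‖p x‖ₑ) fun x _ => by
        rw [← him, ← ofReal_norm]
        exact ENNReal.ofReal_le_ofReal (RCLike.abs_im_le_norm _)
    simp only [add_div, Finset.sum_add_distrib]
    refine (ENNReal.ofReal_le_ofReal (add_le_add hA2 hA'2)).trans ?_
    rw [← mul_add, ENNReal.ofReal_mul hC0, ENNReal.ofReal_add
      (integral_nonneg fun t => abs_nonneg _) (integral_nonneg fun t => abs_nonneg _)]
    refine (mul_le_mul_right (add_le_add e1 e2) _).trans ?_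
    rw [← two_mul, ← mul_assoc]
    refine mul_le_mul_left ?_ _
    rw [show (2 : ENNReal) = ENNReal.ofReal 2 by simp, ← ENNReal.ofReal_mul hC0]
    exact ENNReal.ofReal_le_ofReal (by linarith)

/-! ### Integration against sublinear measures. -/

/-- For each fixed `ε` the condition is a closed one on `C`, so the infimum is attained. -/
lemma sublinearBound_sublinearNorm {μ : Measure ℝ} [IsFiniteMeasure μ] (hμ : IsSublinear μ) :
    SublinearBound μ (sublinearNorm μ) := by
  intro ε h0 h1
  obtain ⟨C₀, hC₀, hC₀'⟩ := hμ
  rw [ENNReal.le_ofReal_iff_toReal_le (measure_ne_top _ _), ← div_le_iff₀ h0]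
  · refine le_csInf ⟨C₀, hC₀.le, hC₀'⟩ fun C hC => ?_
    rw [div_le_iff₀ h0]
    exact ENNReal.toReal_le_of_le_ofReal (mul_nonneg hC.1 h0.le) (hC.2 ε h0 h1)
  · exact mul_nonneg (Real.sInf_nonneg fun C hC => hC.1) h0.le

lemma sublinearNorm_nonneg (μ : Measure ℝ) : 0 ≤ sublinearNorm μ :=
  Real.sInf_nonneg fun _ hC => hC.1

/-- This is the endpoint `ε = 1`, excluded from the definition and recovered by exhaustion. The
point 0 stays out, as its mass is not controlled. -/
lemma SublinearBound.measure_Ioc_le {μ : Measure ℝ} {S : ℝ} (h : SublinearBound μ S) :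
    μ (Set.Ioc 0 1) ≤ ENNReal.ofReal S := by
  obtain ⟨u, hu, hu1, hlim⟩ := exists_seq_strictAnti_tendsto' (zero_lt_one' ℝ)
  have hunion : Set.Ioc (0 : ℝ) 1 = ⋃ n, Set.Icc (u n) 1 := by
    ext x
    simp only [Set.mem_Ioc, Set.mem_iUnion, Set.mem_Icc]
    constructor
    · rintro ⟨h0, h1⟩
      obtain ⟨n, hn⟩ := (hlim.eventually_le_const h0).exists
      exact ⟨n, hn, h1⟩
    · rintro ⟨n, h0, h1⟩
      exact ⟨(hu1 n).1.trans_le h0, h1⟩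
  have hmono : Monotone fun n => Set.Icc (u n) 1 := fun m n hmn =>
    Set.Icc_subset_Icc_left (hu.antitone hmn)
  rw [hunion]
  have ht := tendsto_measure_iUnion_atTop (μ := μ) hmono
  have ht' : Filter.Tendsto (fun n => ENNReal.ofReal (S * (1 - u n))) Filter.atTop
      (nhds (ENNReal.ofReal S)) := by
    have := ENNReal.tendsto_ofReal ((hlim.const_sub 1).const_mul S)
    simpa using this
  refine le_of_tendsto_of_tendsto' ht ht' fun n => ?_
  have := h (1 - u n) (by linarith [(hu1 n).2]) (by linarith [(hu1 n).1])
  simpa using this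

lemma SublinearBound.measure_singleton_one {μ : Measure ℝ} {S : ℝ} (h : SublinearBound μ S) :
    μ {1} = 0 := by
  obtain ⟨u, -, hu1, hlim⟩ := exists_seq_strictAnti_tendsto' (zero_lt_one' ℝ)
  have ht' : Filter.Tendsto (fun n => ENNReal.ofReal (S * u n)) Filter.atTop (nhds 0) := by
    have := ENNReal.tendsto_ofReal (hlim.const_mul S)
    simpa using this
  refine le_antisymm (ge_of_tendsto' ht' fun n => ?_) (zero_le)
  refine (measure_mono ?_).trans (h (u n) (hu1 n).1 (hu1 n).2)
  rw [Set.singleton_subset_iff]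
  exact ⟨by linarith [(hu1 n).1], le_rfl⟩

/-- Sublinear measures integrate increasing functions like multiples of Lebesgue measure. -/
lemma SublinearBound.lintegral_le_of_monotoneOn {μ : Measure ℝ} {S : ℝ}
    (h : SublinearBound μ S) {G : ℝ → ℝ} (hGm : Measurable G)
    (hG : MonotoneOn G (Set.Ioo 0 1)) (hG0 : ∀ x ∈ Set.Ioo (0 : ℝ) 1, 0 ≤ G x) :
    ∫⁻ x in Set.Ioo 0 1, ENNReal.ofReal (G x) ∂μ ≤
      ENNReal.ofReal S * ∫⁻ x in Set.Ioo 0 1, ENNReal.ofReal (G x) := by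
  have hae : ∀ m : Measure ℝ, 0 ≤ᵐ[m.restrict (Set.Ioo 0 1)] G := fun m => by
    filter_upwards [ae_restrict_mem measurableSet_Ioo] with x hx using hG0 x hx
  rw [lintegral_eq_lintegral_meas_lt _ (hae μ) hGm.aemeasurable,
    lintegral_eq_lintegral_meas_lt _ (hae volume) hGm.aemeasurable,
    ← lintegral_const_mul' _ _ ENNReal.ofReal_ne_top]
  refine lintegral_mono fun u => ?_
  have hms : MeasurableSet {x | u < G x} := measurableSet_lt measurable_const hGm
  rw [Measure.restrict_apply hms, Measure.restrict_apply hms]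
  set A := {x | u < G x} ∩ Set.Ioo 0 1 with hA
  rcases A.eq_empty_or_nonempty with hE | hE
  · rw [hE, measure_empty]; exact zero_le
  have hbdd : BddBelow A := ⟨0, fun x hx => hx.2.1.le⟩
  -- The superlevel set lies between `Ioo y 1` and `Icc y 1`: the first bounds its Lebesgue measure
  -- from below, the second its `μ`-measure from above.
  set y := sInf A with hy
  have hy0 : 0 ≤ y := le_csInf hE fun x hx => hx.2.1.le
  obtain ⟨z, hz⟩ := hE
  have hy1 : y < 1 := (csInf_le hbdd hz).trans_lt hz.2.2
  have hsub : Set.Ioo y 1 ⊆ A := by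
    intro x hx
    obtain ⟨v, hv, hvx⟩ := exists_lt_of_csInf_lt ⟨z, hz⟩ hx.1
    have hx0 : x ∈ Set.Ioo (0 : ℝ) 1 := ⟨hy0.trans_lt hx.1, hx.2⟩
    exact ⟨lt_of_lt_of_le hv.1 (hG hv.2 hx0 hvx.le), hx0⟩
  have hvol : ENNReal.ofReal (1 - y) ≤ volume A := by
    rw [← Real.volume_Ioo]
    exact measure_mono hsub
  have hμ : μ A ≤ ENNReal.ofReal (S * (1 - y)) := by
    rcases hy0.eq_or_lt with hy' | hy'
    · rw [← hy', sub_zero, mul_one]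
      refine (measure_mono fun x hx => ?_).trans h.measure_Ioc_le
      exact ⟨hx.2.1, hx.2.2.le⟩
    · refine (measure_mono fun x hx => ?_).trans (h (1 - y) (by linarith) (by linarith))
      rw [sub_sub_cancel]
      exact ⟨csInf_le hbdd hx, hx.2.2.le⟩
  rw [ENNReal.ofReal_mul' (by linarith)] at hμ
  exact hμ.trans (mul_le_mul_right hvol _)

lemma ae_mem_Ico_of_sublinear {μ : Measure ℝ} {S : ℝ} (h : SublinearBound μ S)
    (hμ : μ (Set.Icc (0 : ℝ) 1)ᶜ = 0) : ∀ᵐ x ∂μ, x ∈ Set.Ico (0 : ℝ) 1 := by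
  have h1 : ∀ᵐ x ∂μ, x ∈ Set.Icc (0 : ℝ) 1 := mem_ae_iff.2 hμ
  have h2 : ∀ᵐ x ∂μ, x ∉ ({1} : Set ℝ) := by
    rw [← measure_eq_zero_iff_ae_notMem]
    exact h.measure_singleton_one
  filter_upwards [h1, h2] with x hx hx1
  exact ⟨hx.1, lt_of_le_of_ne hx.2 hx1⟩

lemma eLpNorm_one_eq_lintegral_Ioo {𝕜 : Type*} [RCLike 𝕜] {μ : Measure ℝ} {S : ℝ}
    (h : SublinearBound μ S) (hμ : μ (Set.Icc (0 : ℝ) 1)ᶜ = 0) {f : ℝ → 𝕜} (hf : f 0 = 0) :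
    eLpNorm f 1 μ = ∫⁻ x in Set.Ioo 0 1, ‖f x‖ₑ ∂μ := by
  rw [eLpNorm_one_eq_lintegral_enorm, ← lintegral_indicator measurableSet_Ioo]
  refine lintegral_congr_ae ?_
  filter_upwards [ae_mem_Ico_of_sublinear h hμ] with x hx
  rcases hx.1.eq_or_lt with h0 | h0
  · rw [← h0, hf]; simp
  · rw [Set.indicator_of_mem (Set.mem_Ioo.2 ⟨h0, hx.2⟩)]

lemma muntzPolynomial_zero {𝕜 : Type*} [RCLike 𝕜] {Λ : ℕ → ℝ} (hΛ : ∀ i, 0 < Λ i) {p : ℝ → 𝕜}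
    (hp : p ∈ muntzPolynomials 𝕜 Λ) : p 0 = 0 := by
  obtain ⟨n₀, a, ha⟩ := exists_eq_sum_of_mem_muntzPolynomials hp
  rw [ha]
  exact Finset.sum_eq_zero fun i _ => by simp [Real.zero_rpow (hΛ i).ne']

lemma continuous_of_mem_muntzPolynomials {𝕜 : Type*} [RCLike 𝕜] {Λ : ℕ → ℝ} (hΛ : ∀ i, 0 < Λ i)
    {p : ℝ → 𝕜} (hp : p ∈ muntzPolynomials 𝕜 Λ) : Continuous p := by
  obtain ⟨n₀, a, ha⟩ := exists_eq_sum_of_mem_muntzPolynomials hp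
  rw [show p = _ from funext ha]
  refine continuous_finsetSum _ fun i _ => continuous_const.mul ?_
  exact RCLike.continuous_ofReal.comp (Real.continuous_rpow_const (hΛ i).le)

/-- The embedding inequality for Müntz polynomials, and the pointwise bound on `[0, 1)`. -/
theorem exists_embedding_and_pointwise_bound (𝕜 : Type*) [RCLike 𝕜] {Λ : ℕ → ℝ}
    (hΛ : IsMuntzSequence Λ) (hq : IsQuasilacunary Λ) :
    ∃ C : ℝ, 0 < C ∧ ∀ p ∈ muntzPolynomials 𝕜 Λ,
      (∀ (μ : Measure ℝ) (S : ℝ), μ (Set.Icc (0 : ℝ) 1)ᶜ = 0 → 0 ≤ S → SublinearBound μ S →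
        eLpNorm p 1 μ ≤ ENNReal.ofReal (C * S) * eLpNorm p 1 lebesgueUnit) ∧
      ∀ x ∈ Set.Ico (0 : ℝ) 1,
        ENNReal.ofReal (1 - x) * ‖p x‖ₑ ≤ ENNReal.ofReal C * eLpNorm p 1 lebesgueUnit := by
  obtain ⟨C, hC0, hC⟩ := exists_monotone_majorant 𝕜 hΛ hq
  refine ⟨C, hC0, fun p hp => ?_⟩
  obtain ⟨G, hGm, hG, hpG, hGC⟩ := hC p hp
  have hpG' : ∀ x ∈ Set.Ioo (0 : ℝ) 1, ‖p x‖ₑ ≤ ENNReal.ofReal (G x) := fun x hx => by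
    rw [← ofReal_norm]
    exact ENNReal.ofReal_le_ofReal (hpG x hx)
  refine ⟨fun μ S hμ hS0 hS => ?_, fun x hx => ?_⟩
  · rw [eLpNorm_one_eq_lintegral_Ioo hS hμ (muntzPolynomial_zero hΛ.pos hp)]
    refine (setLIntegral_mono' measurableSet_Ioo hpG').trans ?_
    refine (hS.lintegral_le_of_monotoneOn hGm hG
      fun x hx => (norm_nonneg _).trans (hpG x hx)).trans ?_
    refine (mul_le_mul_right hGC _).trans_eq ?_
    rw [ENNReal.ofReal_mul hC0.le, ← mul_assoc, mul_comm (ENNReal.ofReal S)]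
  · rcases hx.1.eq_or_lt with h0 | h0
    · rw [← h0, muntzPolynomial_zero hΛ.pos hp]
      simp
    -- Since `G` increases, `(1 - x) * G x` is at most the integral of `G` over `(x, 1)`.
    · refine le_trans ?_ hGC
      rw [← Real.volume_Ioo, mul_comm, ← setLIntegral_const]
      refine (setLIntegral_mono' measurableSet_Ioo fun y hy => ?_).trans
        (lintegral_mono_set (Set.Ioo_subset_Ioo_left h0.le))
      exact (hpG' x ⟨h0, hx.2⟩).trans
        (ENNReal.ofReal_le_ofReal (hG ⟨h0, hx.2⟩ ⟨h0.trans hy.1, hy.2⟩ hy.1.le))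

/-! ### Passage to the closed span. -/

lemma exists_muntzPolynomials_tendsto {𝕜 : Type*} [RCLike 𝕜] {Λ : ℕ → ℝ}
    {F : Lp 𝕜 1 lebesgueUnit} (hF : F ∈ muntzSpace 𝕜 Λ) :
    ∃ p : ℕ → ℝ → 𝕜, (∀ k, p k ∈ muntzPolynomials 𝕜 Λ) ∧
      Filter.Tendsto (fun k => eLpNorm (p k - ⇑F) 1 lebesgueUnit) Filter.atTop (nhds 0) := by
  have hspan : ∀ g ∈ Submodule.span 𝕜
      {F : Lp 𝕜 1 lebesgueUnit | ∃ i, F =ᵐ[lebesgueUnit] monomialFun 𝕜 (Λ i)},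
      ∃ p ∈ muntzPolynomials 𝕜 Λ, g =ᵐ[lebesgueUnit] p := by
    intro g hg
    induction hg using Submodule.span_induction with
    | mem g hg =>
      obtain ⟨i, hi⟩ := hg
      exact ⟨_, Submodule.subset_span ⟨i, rfl⟩, hi⟩
    | zero => exact ⟨0, Submodule.zero_mem _, Lp.coeFn_zero _ _ _⟩
    | add g h _ _ ihg ihh =>
      obtain ⟨p, hp, hgp⟩ := ihg
      obtain ⟨r, hr, hhr⟩ := ihh
      exact ⟨p + r, Submodule.add_mem _ hp hr, (Lp.coeFn_add g h).trans (hgp.add hhr)⟩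
    | smul c g _ ih =>
      obtain ⟨p, hp, hgp⟩ := ih
      exact ⟨c • p, Submodule.smul_mem _ c hp, (Lp.coeFn_smul c g).trans (hgp.const_smul c)⟩
  obtain ⟨g, hg, hlim⟩ := mem_closure_iff_seq_limit.1 hF
  choose p hp hgp using fun k => hspan (g k) (hg k)
  refine ⟨p, hp, ?_⟩
  refine ((Lp.tendsto_Lp_iff_tendsto_eLpNorm' g F).1 hlim).congr fun k => ?_
  exact eLpNorm_congr_ae ((hgp k).sub Filter.EventuallyEq.rfl)

lemma eLpNorm_sub_le_add_of_muntz {𝕜 : Type*} [RCLike 𝕜] {Λ : ℕ → ℝ} (hΛ : ∀ i, 0 < Λ i)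
    {F : ℝ → 𝕜} (hF : AEStronglyMeasurable F lebesgueUnit) {p r : ℝ → 𝕜} (hp : p ∈ muntzPolynomials 𝕜 Λ)
    (hr : r ∈ muntzPolynomials 𝕜 Λ) :
    eLpNorm (p - r) 1 lebesgueUnit ≤
      eLpNorm (p - F) 1 lebesgueUnit + eLpNorm (r - F) 1 lebesgueUnit := by
  have hpm := (continuous_of_mem_muntzPolynomials hΛ hp).aestronglyMeasurable (μ := lebesgueUnit)
  have hrm := (continuous_of_mem_muntzPolynomials hΛ hr).aestronglyMeasurable (μ := lebesgueUnit)
  rw [← sub_sub_sub_cancel_right p r F]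
  exact eLpNorm_sub_le (hpm.sub hF) (hrm.sub hF) le_rfl

lemma uniformCauchySeqOn_of_pointwise_bound {𝕜 : Type*} [RCLike 𝕜] {Λ : ℕ → ℝ}
    (hΛ : ∀ i, 0 < Λ i) {C : ℝ} (hC0 : 0 < C)
    (hC : ∀ p ∈ muntzPolynomials 𝕜 Λ, ∀ x ∈ Set.Ico (0 : ℝ) 1,
      ENNReal.ofReal (1 - x) * ‖p x‖ₑ ≤ ENNReal.ofReal C * eLpNorm p 1 lebesgueUnit)
    {F : ℝ → 𝕜} (hF : AEStronglyMeasurable F lebesgueUnit) {p : ℕ → ℝ → 𝕜} (hp : ∀ k, p k ∈ muntzPolynomials 𝕜 Λ)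
    (hlim : Filter.Tendsto (fun k => eLpNorm (p k - F) 1 lebesgueUnit) Filter.atTop (nhds 0))
    {r : ℝ} (hr : r < 1) : UniformCauchySeqOn p Filter.atTop (Set.Icc 0 r) := by
  rw [Metric.uniformCauchySeqOn_iff]
  intro ε hε
  set δ := (1 - r) * ε / (4 * C) with hδ
  have h1r : 0 < 1 - r := by linarith
  have hδ0 : 0 < δ := by positivity
  obtain ⟨k₀, hk₀⟩ := Filter.eventually_atTop.1
    (hlim.eventually_le_const (ENNReal.ofReal_pos.2 hδ0))
  refine ⟨k₀, fun m hm n hn x hx => ?_⟩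
  have h1 := hC _ (Submodule.sub_mem _ (hp m) (hp n)) x ⟨hx.1, hx.2.trans_lt hr⟩
  have h2 := (eLpNorm_sub_le_add_of_muntz hΛ hF (hp m) (hp n)).trans
    (add_le_add (hk₀ m hm) (hk₀ n hn))
  have h3 := h1.trans (mul_le_mul_right h2 _)
  have hx1 : 0 ≤ 1 - x := by linarith [hx.2]
  rw [← ENNReal.ofReal_add hδ0.le hδ0.le, ← ENNReal.ofReal_mul hC0.le, ← ofReal_norm,
    ← ENNReal.ofReal_mul hx1, ENNReal.ofReal_le_ofReal_iff (by positivity), Pi.sub_apply,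
    ← dist_eq_norm] at h3
  have h4 : (1 - r) * dist (p m x) (p n x) ≤ (1 - r) * (ε / 2) := by
    calc (1 - r) * dist (p m x) (p n x) ≤ (1 - x) * dist (p m x) (p n x) :=
          mul_le_mul_of_nonneg_right (by linarith [hx.2]) dist_nonneg
      _ ≤ C * (δ + δ) := h3
      _ = _ := by rw [hδ]; field_simp; ring
  linarith [le_of_mul_le_mul_left h4 h1r]

/-- A sequence that is uniformly Cauchy on every `[0, r]` with `r < 1` has a limit that is
continuous on `[0, 1)`. -/
lemma exists_continuousOn_Ico_limit {E : Type*} [NormedAddCommGroup E] [CompleteSpace E]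
    {p : ℕ → ℝ → E} (hp : ∀ k, Continuous (p k))
    (hcauchy : ∀ r < 1, UniformCauchySeqOn p Filter.atTop (Set.Icc 0 r)) :
    ∃ f : ℝ → E, ContinuousOn f (Set.Ico 0 1) ∧
      ∀ x ∈ Set.Ico (0 : ℝ) 1, Filter.Tendsto (fun k => p k x) Filter.atTop (nhds (f x)) := by
  have hlim : ∀ x, ∃ y, x ∈ Set.Ico (0 : ℝ) 1 →
      Filter.Tendsto (fun k => p k x) Filter.atTop (nhds y) := fun x => by
    by_cases hx : x ∈ Set.Ico (0 : ℝ) 1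
    · obtain ⟨y, hy⟩ := cauchySeq_tendsto_of_complete
        ((hcauchy x hx.2).cauchySeq (Set.right_mem_Icc.2 hx.1))
      exact ⟨y, fun _ => hy⟩
    · exact ⟨0, fun h => absurd h hx⟩
  choose f hlim using hlim
  refine ⟨f, fun x hx => ?_, hlim⟩
  obtain ⟨r, hxr, hr⟩ := exists_between hx.2
  have hunif := (hcauchy r hr).tendstoUniformlyOn_of_tendsto
    fun y hy => hlim y ⟨hy.1, hy.2.trans_lt hr⟩
  have hcont := hunif.continuousOn (Filter.Frequently.of_forall fun k => (hp k).continuousOn)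
  refine (hcont x ⟨hx.1, hxr.le⟩).mono_of_mem_nhdsWithin ?_
  filter_upwards [self_mem_nhdsWithin, mem_nhdsWithin_of_mem_nhds (Iio_mem_nhds hxr)] with y hy hyr
  exact ⟨hy.1, le_of_lt hyr⟩

lemma ae_lebesgueUnit_mem_Ico : ∀ᵐ x ∂lebesgueUnit, x ∈ Set.Ico (0 : ℝ) 1 := by
  rw [lebesgueUnit, ← restrict_Ico_eq_restrict_Icc]
  exact ae_restrict_mem measurableSet_Ico

lemma eLpNorm_le_add_of_muntz {𝕜 : Type*} [RCLike 𝕜] {Λ : ℕ → ℝ} (hΛ : ∀ i, 0 < Λ i)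
    {F : ℝ → 𝕜} (hF : AEStronglyMeasurable F lebesgueUnit) {p : ℝ → 𝕜} (hp : p ∈ muntzPolynomials 𝕜 Λ) :
    eLpNorm p 1 lebesgueUnit ≤ eLpNorm F 1 lebesgueUnit + eLpNorm (p - F) 1 lebesgueUnit := by
  have hpm := (continuous_of_mem_muntzPolynomials hΛ hp).aestronglyMeasurable
    (μ := lebesgueUnit)
  have := eLpNorm_add_le hF (hpm.sub hF) le_rfl
  rwa [add_sub_cancel] at this

theorem mainTheorem1 {𝕜 : Type*} [RCLike 𝕜] (Λ : ℕ → ℝ) (hΛ : IsMuntzSequence Λ)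
    (hq : IsQuasilacunary Λ) :
    ∃ C : ℝ, 0 < C ∧
      ∀ (μ : Measure ℝ) [IsFiniteMeasure μ], μ (Set.Icc (0 : ℝ) 1)ᶜ = 0 → IsSublinear μ →
        -- `μ` is `Λ`-embedding, with constant `C ‖μ‖_S` on Müntz polynomials
        IsEmbeddingMeasure 𝕜 Λ μ ∧
        (∀ p ∈ muntzPolynomials 𝕜 Λ,
          eLpNorm p 1 μ ≤ ENNReal.ofReal (C * sublinearNorm μ) * eLpNorm p 1 lebesgueUnit) ∧
        -- the same on all of `M_Λ^1`, whose elements are functions continuous on `[0,1)`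
        ∀ F ∈ muntzSpace 𝕜 Λ,
          (∃ f : ℝ → 𝕜, ContinuousOn f (Set.Ico 0 1) ∧ f =ᵐ[lebesgueUnit] F) ∧
          ∀ f : ℝ → 𝕜, ContinuousOn f (Set.Ico 0 1) → f =ᵐ[lebesgueUnit] F →
            MemLp f 1 μ ∧
            eLpNorm f 1 μ ≤
              ENNReal.ofReal (C * sublinearNorm μ) * eLpNorm f 1 lebesgueUnit := by
  obtain ⟨C, hC0, hC⟩ := exists_embedding_and_pointwise_bound 𝕜 hΛ hq
  refine ⟨C, hC0, fun μ _ hμ hsub => ?_⟩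
  have hS := sublinearBound_sublinearNorm hsub
  have hS0 := sublinearNorm_nonneg μ
  have hpoly : ∀ p ∈ muntzPolynomials 𝕜 Λ,
      eLpNorm p 1 μ ≤ ENNReal.ofReal (C * sublinearNorm μ) * eLpNorm p 1 lebesgueUnit :=
    fun p hp => (hC p hp).1 μ _ hμ hS0 hS
  -- The norm may vanish, whereas an embedding constant must be positive.
  refine ⟨⟨C * sublinearNorm μ + 1, by positivity, fun p hp => (hpoly p hp).trans ?_⟩, hpoly,
    fun F hF => ?_⟩
  · exact mul_le_mul_left (ENNReal.ofReal_le_ofReal (by linarith)) _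
  have hFm := Lp.aestronglyMeasurable F
  obtain ⟨p, hp, hlim⟩ := exists_muntzPolynomials_tendsto hF
  have hpc := fun k => continuous_of_mem_muntzPolynomials hΛ.pos (hp k)
  obtain ⟨g, hg, hpg⟩ := exists_continuousOn_Ico_limit hpc fun r hr =>
    uniformCauchySeqOn_of_pointwise_bound hΛ.pos hC0 (fun p hp => (hC p hp).2)
      hFm hp hlim hr
  have hgF : g =ᵐ[lebesgueUnit] F := by
    obtain ⟨ns, hns, hae⟩ := (tendstoInMeasure_of_tendsto_eLpNorm one_ne_zero
      (fun k => (hpc k).aestronglyMeasurable) hFm hlim).exists_seq_tendsto_ae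
    filter_upwards [hae, ae_lebesgueUnit_mem_Ico] with x hx hx1
    exact tendsto_nhds_unique ((hpg x hx1).comp hns.tendsto_atTop) hx
  refine ⟨⟨g, hg, hgF⟩, fun f hf hfF => ?_⟩
  -- Equality almost everywhere for Lebesgue measure says nothing about a singular `μ`; continuity
  -- upgrades it to equality at every point of `[0, 1)`, which carries `μ`.
  have hfg : Set.EqOn f g (Set.Ico 0 1) := by
    refine Measure.eqOn_Ico_of_ae_eq volume ?_ hf hg
    rw [restrict_Ico_eq_restrict_Icc]
    exact hfF.trans hgF.symm
  have hae : ∀ᵐ x ∂μ, Filter.Tendsto (fun k => p k x) Filter.atTop (nhds (f x)) := by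
    filter_upwards [ae_mem_Ico_of_sublinear hS hμ] with x hx
    rw [hfg hx]
    exact hpg x hx
  have hle : eLpNorm f 1 μ ≤
      ENNReal.ofReal (C * sublinearNorm μ) * eLpNorm f 1 lebesgueUnit := by
    -- Fatou's lemma: pointwise convergence `μ`-almost everywhere suffices, without convergence in
    -- `L^1(μ)`.
    have h1 := Lp.eLpNorm_lim_le_liminf_eLpNorm (p := 1) (μ := μ)
      (fun k => (hpc k).aestronglyMeasurable) f hae
    have h2 : Filter.Tendsto (fun k => ENNReal.ofReal (C * sublinearNorm μ) *
        (eLpNorm F 1 lebesgueUnit + eLpNorm (p k - ⇑F) 1 lebesgueUnit)) Filter.atTop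
        (nhds (ENNReal.ofReal (C * sublinearNorm μ) * eLpNorm F 1 lebesgueUnit)) := by
      have := hlim.const_add (eLpNorm F 1 lebesgueUnit)
      rw [add_zero] at this
      exact ENNReal.Tendsto.const_mul this (Or.inr ENNReal.ofReal_ne_top)
    rw [eLpNorm_congr_ae hfF, ← h2.liminf_eq]
    refine h1.trans (Filter.liminf_le_liminf (Filter.Eventually.of_forall fun k => ?_))
    exact (hpoly _ (hp k)).trans (mul_le_mul_right (eLpNorm_le_add_of_muntz hΛ.pos hFm (hp k)) _)
  refine ⟨⟨aestronglyMeasurable_of_tendsto_ae Filter.atTop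
    (fun k => (hpc k).aestronglyMeasurable) hae, hle.trans_lt ?_⟩, hle⟩
  rw [eLpNorm_congr_ae hfF]
  exact ENNReal.mul_lt_top ENNReal.ofReal_lt_top (Lp.eLpNorm_lt_top F)
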